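/- Let $n\ge 1$ and let $(M,J)$ be a closed connected complex manifold of real dimension $2n+2$. A Riemannian metric $g$ and a $1$-form $\theta$ form a Vaisman structure on $(M,J)$, with Lee form $\theta$, if $g$ is Hermitian, $\theta$ is parallel for the Levi-Civita connection $\nabla$ of $g$, and $\omega(X,Y)=g(X,JY)$ satisfies $d\omega=\theta\wedge\omega$. Suppose $(M,g,\theta)$ is a Vaisman structure with $\|\theta\|=1$. Put $\theta^c=\theta\circ J$, $U=\theta^\sharp$, $V=(\theta^c)^\sharp$, let $\mathcal F$ be the (canonical) foliation spanned by $U,V$, let $Q=(T\mathcal F)^{\perp}$ with orthogonal projection $\pi_Q$, and let $\nabla^T$ be the Bott connection on $Q$: $\nabla^T_XY=\pi_Q(\nabla_XY)$ for $X\in\Gamma(Q)$ and $\nabla^T_XY=\pi_Q([X,Y])$ for $X\in\Gamma(T\mathcal F)$. Let $R^T$ be its curvature and $\mathrm{Ric}^T(X,Y)=\mathrm{tr}_Q\big(Z\mapsto R^T(Z,X)Y\big)$ for $X,Y\in Q$. Assume that $g$ is transversally Kähler–Einstein with constant $\lambda+\tfrac12>0$ ($\lambda\in\mathbb R$), that is,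 $\mathrm{Ric}^T(X,Y)=(\lambda+\tfrac12)\,g(X,Y)$ for all $X,Y\in Q$. Then there is a constant $a>0$ such that the $Q$-homothetic deformation $$\tilde\theta=a\,\theta,\qquad \tilde g=a\,g+(a^2-a)\,(\theta\otimes\theta+\theta^c\otimes\theta^c)$$ is a Vaisman structure $(M,\tilde g,\tilde\theta)$ on the same complex manifold $(M,J)$ and $(\tilde g,\tilde\theta)$ is an Einstein–Weyl structure. Here $(\tilde g,\tilde\theta)$ is called Einstein–Weyl if the Ricci tensor $\mathrm{Ric}^D$ of the connection $D_XY=\tilde\nabla_XY-\tfrac12\big(\tilde\theta(X)Y+\tilde\theta(Y)X-\tilde g(X,Y)\tilde\theta^{\sharp}\big)$, where $\tilde\nabla$ is the Levi-Civita connection of $\tilde g$ and $\sharp$ is taken with respect to $\tilde g$, is a constant multiple of the metric of the universal covering of which $D$ is the Levi-Civita connection; that is, near every point of $M$ one has $\tilde\theta=df$ and $\mathrm{Ric}^D=c\,e^{-f}\tilde g$ for some smooth function $f$ and some $c\in\mathbb R$. -/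

import Mathlib

open scoped Manifold ContDiff Bundle Topology

noncomputable section

namespace Vaisman

/-- The model space `ℝ^N`. -/
abbrev Rn (N : ℕ) := EuclideanSpace ℝ (Fin N)

/-- Bilinear forms on `ℝ^N`. -/
abbrev Bil (N : ℕ) := Rn N →L[ℝ] Rn N →L[ℝ] ℝ

/-! ### Tensor calculus in one coordinate chart

Here `G`, `J`, `θ` are the coordinate expressions of a Riemannian metric, of an endomorphism field
and of a 1-form; vector fields are functions `Rn N → Rn N`. All operators are local: only the
values of the fields near the point of evaluation matter. -/

section Coordinates

variable {N : ℕ}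

/-- The vector dual to the covector `α` with respect to the metric `G` at `y`. -/
def sharp (G : Rn N → Bil N) (y : Rn N) (α : Rn N →L[ℝ] ℝ) : Rn N :=
  (G y).inverse α

/-- The Christoffel map `Γ_y(u,v)`, given by the coordinate form of Koszul's formula
`2 g(Γ(u,v),w) = (∂_u g)(v,w) + (∂_v g)(u,w) - (∂_w g)(u,v)`. -/
def christoffel (G : Rn N → Bil N) (y u v : Rn N) : Rn N :=
  sharp G y ((1 / 2 : ℝ) •
    (fderiv ℝ G y u v + fderiv ℝ G y v u - ((fderiv ℝ G y).flip u).flip v))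

/-- The Levi-Civita connection `∇_X Y` of `G`. -/
def leviCivita (G : Rn N → Bil N) (X Y : Rn N → Rn N) (y : Rn N) : Rn N :=
  fderiv ℝ Y y (X y) + christoffel G y (X y) (Y y)

/-- The curvature `R(X,Y)Z = C_X C_Y Z - C_Y C_X Z - C_{[X,Y]} Z` of a covariant derivative `C`. -/
def curvature (C : (Rn N → Rn N) → (Rn N → Rn N) → Rn N → Rn N) (X Y Z : Rn N → Rn N) :
    Rn N → Rn N := fun y =>
  C X (C Y Z) y - C Y (C X Z) y - C (VectorField.lieBracket ℝ X Y) Z y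

/-- The constant coordinate vector `∂_i`. -/
def coordVec (i : Fin N) : Rn N := EuclideanSpace.single i 1

/-- The Ricci tensor `Ric(v,w) = tr (u ↦ R(u,v)w)` of a covariant derivative `C`. -/
def ricci (C : (Rn N → Rn N) → (Rn N → Rn N) → Rn N → Rn N) (y v w : Rn N) : ℝ :=
  ∑ i : Fin N, (curvature C (fun _ => coordVec i) (fun _ => v) (fun _ => w) y) i

/-- The Weyl connection
`D_X Y = ∇_X Y - (1/2) (θ(X) Y + θ(Y) X - g(X,Y) θ^♯)` of the pair `(g, θ)`. -/
def weylConnection (G : Rn N → Bil N) (θ : Rn N → Rn N →L[ℝ] ℝ) (X Y : Rn N → Rn N)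
    (y : Rn N) : Rn N :=
  leviCivita G X Y y -
    (1 / 2 : ℝ) • (θ y (X y) • Y y + θ y (Y y) • X y - G y (X y) (Y y) • sharp G y (θ y))

/-- The anti-Lee form `θ ∘ J`. -/
def antiLee (J : Rn N → Rn N →L[ℝ] Rn N) (θ : Rn N → Rn N →L[ℝ] ℝ) (y : Rn N) :
    Rn N →L[ℝ] ℝ := (θ y).comp (J y)

/-- The orthogonal projection of `u` onto `Q`, the orthogonal complement of the span of
`U = θ^♯` and `V = (θ ∘ J)^♯`, for a Hermitian metric and a 1-form `θ` of norm one
(then `U`, `V` are orthonormal). -/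
def projQ (G : Rn N → Bil N) (J : Rn N → Rn N →L[ℝ] Rn N) (θ : Rn N → Rn N →L[ℝ] ℝ)
    (y u : Rn N) : Rn N :=
  u - θ y u • sharp G y (θ y) - antiLee J θ y u • sharp G y (antiLee J θ y)

/-- The Bott connection on `Q`: `π_Q(∇_X Y)` for `X` tangent to `Q`, and `π_Q [X,Y]` for `X` tangent
to the foliation spanned by `U` and `V`; a general `X` is split into its two components. -/
def bott (G : Rn N → Bil N) (J : Rn N → Rn N →L[ℝ] Rn N) (θ : Rn N → Rn N →L[ℝ] ℝ)
    (X Y : Rn N → Rn N) (y : Rn N) : Rn N :=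
  projQ G J θ y
    (leviCivita G (fun z => projQ G J θ z (X z)) Y y +
      VectorField.lieBracket ℝ (fun z => X z - projQ G J θ z (X z)) Y y)

/-- The transverse Ricci tensor `Ric^T(v,w)`, the trace over `Q` of `u ↦ R^T(u,v)w`, where `R^T` is
the curvature of the Bott connection; `v`, `w` and the coordinate vectors are extended to
sections of `Q` by projecting constant fields. -/
def transverseRicci (G : Rn N → Bil N) (J : Rn N → Rn N →L[ℝ] Rn N) (θ : Rn N → Rn N →L[ℝ] ℝ)
    (y v w : Rn N) : ℝ :=
  ∑ i : Fin N, (curvature (bott G J θ) (fun z => projQ G J θ z (coordVec i))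
    (fun z => projQ G J θ z v) (fun z => projQ G J θ z w) y) i

/-- The fundamental 2-form `ω(u,v) = g(u, J v)`. -/
def fundForm (G : Rn N → Bil N) (J : Rn N → Rn N →L[ℝ] Rn N) (y u v : Rn N) : ℝ :=
  G y u (J y v)

/-- The exterior derivative of a 2-form `Ω`, on constant vectors. -/
def extDerivTwo (Ω : Rn N → Rn N → Rn N → ℝ) (y u v w : Rn N) : ℝ :=
  fderiv ℝ (fun z => Ω z v w) y u + fderiv ℝ (fun z => Ω z w u) y v +
    fderiv ℝ (fun z => Ω z u v) y w

/-- The wedge product `θ ∧ Ω` of a 1-form and a 2-form. -/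
def wedgeOneTwo (θ : Rn N → Rn N →L[ℝ] ℝ) (Ω : Rn N → Rn N → Rn N → ℝ) (y u v w : Rn N) : ℝ :=
  θ y u * Ω y v w + θ y v * Ω y w u + θ y w * Ω y u v

/-- The covariant derivative `(∇_u θ)(v)` of a 1-form for the Levi-Civita connection. -/
def nablaForm (G : Rn N → Bil N) (θ : Rn N → Rn N →L[ℝ] ℝ) (y u v : Rn N) : ℝ :=
  fderiv ℝ θ y u v - θ y (christoffel G y u v)

/-- The Nijenhuis tensor `[JX,JY] - J[JX,Y] - J[X,JY] - [X,Y]`. -/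
def nijenhuis (J : Rn N → Rn N →L[ℝ] Rn N) (X Y : Rn N → Rn N) (y : Rn N) : Rn N :=
  VectorField.lieBracket ℝ (fun z => J z (X z)) (fun z => J z (Y z)) y
    - J y (VectorField.lieBracket ℝ (fun z => J z (X z)) Y y)
    - J y (VectorField.lieBracket ℝ X (fun z => J z (Y z)) y)
    - VectorField.lieBracket ℝ X Y y

end Coordinates

/-! ### Objects on a manifold and their coordinate expressions -/

section Manifold

/-- Fields of covectors on `M`. -/
abbrev CovectorField (N : ℕ) (M : Type*) [TopologicalSpace M] [ChartedSpace (Rn N) M] :=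
  (x : M) → TangentSpace 𝓘(ℝ, Rn N) x →L[ℝ] ℝ

/-- Fields of endomorphisms of the tangent spaces of `M`. -/
abbrev EndoField (N : ℕ) (M : Type*) [TopologicalSpace M] [ChartedSpace (Rn N) M] :=
  (x : M) → TangentSpace 𝓘(ℝ, Rn N) x →L[ℝ] TangentSpace 𝓘(ℝ, Rn N) x

variable {N : ℕ} {M : Type*} [TopologicalSpace M] [ChartedSpace (Rn N) M]

/-- The derivative at `y` of the inverse of the chart around `p`. -/
def chartInvDeriv (p : M) (y : Rn N) :
    Rn N →L[ℝ] TangentSpace 𝓘(ℝ, Rn N) ((chartAt (Rn N) p).symm y) :=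
  mfderiv 𝓘(ℝ, Rn N) 𝓘(ℝ, Rn N) (chartAt (Rn N) p).symm y

/-- The derivative, at the point with coordinates `y`, of the chart around `p`. -/
def chartDeriv (p : M) (y : Rn N) :
    TangentSpace 𝓘(ℝ, Rn N) ((chartAt (Rn N) p).symm y) →L[ℝ] Rn N :=
  mfderiv 𝓘(ℝ, Rn N) 𝓘(ℝ, Rn N) (chartAt (Rn N) p) ((chartAt (Rn N) p).symm y)

/-- Coordinate expression of a 1-form in the chart around `p`. -/
def covInChart (θ : CovectorField N M) (p : M) (y : Rn N) : Rn N →L[ℝ] ℝ :=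
  (θ ((chartAt (Rn N) p).symm y)).comp (chartInvDeriv p y)

/-- Coordinate expression of an endomorphism field in the chart around `p`. -/
def endoInChart (J : EndoField N M) (p : M) (y : Rn N) : Rn N →L[ℝ] Rn N :=
  ((chartDeriv p y).comp (J ((chartAt (Rn N) p).symm y))).comp (chartInvDeriv p y)

variable [IsManifold 𝓘(ℝ, Rn N) ∞ M]

variable (N M) in
/-- Smooth Riemannian metrics on `M`. -/
abbrev Metric :=
  Bundle.ContMDiffRiemannianMetric 𝓘(ℝ, Rn N) ∞ (Rn N)
    (fun x : M => TangentSpace 𝓘(ℝ, Rn N) x)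

/-- Coordinate expression of a metric in the chart around `p`. -/
def metricInChart (g : Metric N M) (p : M) (y : Rn N) : Bil N :=
  (ContinuousLinearMap.precomp ℝ (chartInvDeriv p y)).comp
    ((g.inner ((chartAt (Rn N) p).symm y)).comp (chartInvDeriv p y))

/-- Smoothness of a 1-form, as a section of the cotangent bundle. -/
def SmoothCovector (θ : CovectorField N M) : Prop :=
  ContMDiff 𝓘(ℝ, Rn N) (𝓘(ℝ, Rn N).prod 𝓘(ℝ, Rn N →L[ℝ] ℝ)) ∞
    (fun x : M => Bundle.TotalSpace.mk' (Rn N →L[ℝ] ℝ)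
      (E := fun x : M => TangentSpace 𝓘(ℝ, Rn N) x →L[ℝ] ℝ) x (θ x))

/-- Smoothness of an endomorphism field, as a section of the endomorphism bundle. -/
def SmoothEndo (J : EndoField N M) : Prop :=
  ContMDiff 𝓘(ℝ, Rn N) (𝓘(ℝ, Rn N).prod 𝓘(ℝ, Rn N →L[ℝ] Rn N)) ∞
    (fun x : M => Bundle.TotalSpace.mk' (Rn N →L[ℝ] Rn N)
      (E := fun x : M => TangentSpace 𝓘(ℝ, Rn N) x →L[ℝ] TangentSpace 𝓘(ℝ, Rn N) x) x (J x))

/-- A complex structure on `M`: a smooth endomorphism field with `J² = -1` whose Nijenhuis tensor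
vanishes. -/
structure IsComplexStructure (J : EndoField N M) : Prop where
  smooth : SmoothEndo J
  sq : ∀ (x : M) (v : TangentSpace 𝓘(ℝ, Rn N) x), J x (J x v) = -v
  integrable : ∀ (p : M), ∀ y ∈ (chartAt (Rn N) p).target, ∀ X Y : Rn N → Rn N,
    ContDiff ℝ ∞ X → ContDiff ℝ ∞ Y → nijenhuis (endoInChart J p) X Y y = 0

/-- The square of the norm of the 1-form `θ` at `x`, that is `θ(θ^♯)`. -/
def normSq (g : Metric N M) (θ : CovectorField N M) (x : M) : ℝ :=
  θ x ((g.inner x).inverse (θ x))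

/-- `(M, J, g)` is Vaisman with Lee form `θ`: `g` is Hermitian, `dω = θ ∧ ω` for the fundamental form
`ω`, and `θ` is parallel for the Levi-Civita connection of `g`. -/
structure IsVaisman (J : EndoField N M) (g : Metric N M) (θ : CovectorField N M) : Prop where
  complex : IsComplexStructure J
  hermitian : ∀ (x : M) (u v : TangentSpace 𝓘(ℝ, Rn N) x),
    g.inner x (J x u) (J x v) = g.inner x u v
  smooth : SmoothCovector θ
  deriv_fundForm : ∀ (p : M), ∀ y ∈ (chartAt (Rn N) p).target, ∀ u v w : Rn N,
    extDerivTwo (fundForm (metricInChart g p) (endoInChart J p)) y u v w =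
      wedgeOneTwo (covInChart θ p) (fundForm (metricInChart g p) (endoInChart J p)) y u v w
  parallel : ∀ (p : M), ∀ y ∈ (chartAt (Rn N) p).target, ∀ u v : Rn N,
    nablaForm (metricInChart g p) (covInChart θ p) y u v = 0

/-- The transverse metric of the canonical foliation is Einstein with constant `κ`:
`Ric^T(v,w) = κ g(v,w)` for all `v`, `w` in `Q = ker θ ∩ ker (θ ∘ J)`. (Used for Vaisman
structures with Lee form of norm one, whose transverse metric is Kähler.) -/
def IsTransverselyKahlerEinstein (J : EndoField N M) (g : Metric N M) (θ : CovectorField N M)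
    (κ : ℝ) : Prop :=
  ∀ (p : M), ∀ y ∈ (chartAt (Rn N) p).target, ∀ v w : Rn N,
    covInChart θ p y v = 0 → antiLee (endoInChart J p) (covInChart θ p) y v = 0 →
    covInChart θ p y w = 0 → antiLee (endoInChart J p) (covInChart θ p) y w = 0 →
    transverseRicci (metricInChart g p) (endoInChart J p) (covInChart θ p) y v w =
      κ * metricInChart g p y v w

/-- `(g', θ')` is the `Q`-homothetic deformation of `(g, θ)` with parameter `a`:
`θ' = a θ` and `g' = a g + (a² - a) (θ ⊗ θ + θ^c ⊗ θ^c)`, where `θ^c = θ ∘ J`. -/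
def IsQHomotheticDeformation (J : EndoField N M) (a : ℝ) (g : Metric N M) (θ : CovectorField N M)
    (g' : Metric N M) (θ' : CovectorField N M) : Prop :=
  (∀ (x : M) (v : TangentSpace 𝓘(ℝ, Rn N) x), θ' x v = a * θ x v) ∧
    ∀ (x : M) (u v : TangentSpace 𝓘(ℝ, Rn N) x),
      g'.inner x u v = a * g.inner x u v +
        (a ^ 2 - a) * (θ x u * θ x v + θ x (J x u) * θ x (J x v))

/-- `(g, θ)` is Einstein-Weyl: near every point `θ = df` for a smooth function `f`, and the Ricci tensor
of the Weyl connection `D` satisfies `Ric^D = c e^{-f} g` with a real constant `c`. The metrics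
`e^{-f} g` are the local expressions of the metric on the universal covering of `M` whose
Levi-Civita connection is the lift of `D`, so this is the Einstein condition for that metric. -/
def IsEinsteinWeyl (g : Metric N M) (θ : CovectorField N M) : Prop :=
  ∀ x₀ : M, ∃ W : Set M, IsOpen W ∧ x₀ ∈ W ∧ ∃ (f : M → ℝ) (c : ℝ),
    ContMDiffOn 𝓘(ℝ, Rn N) 𝓘(ℝ, ℝ) ∞ f W ∧
    (∀ x ∈ W, ∀ v : TangentSpace 𝓘(ℝ, Rn N) x, mfderiv 𝓘(ℝ, Rn N) 𝓘(ℝ, ℝ) f x v = θ x v) ∧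
    ∀ (p : M), ∀ y ∈ (chartAt (Rn N) p).target, (chartAt (Rn N) p).symm y ∈ W → ∀ v w : Rn N,
      ricci (weylConnection (metricInChart g p) (covInChart θ p)) y v w =
        c * Real.exp (-f ((chartAt (Rn N) p).symm y)) * metricInChart g p y v w

end Manifold

end Vaisman

end

noncomputable section

set_option maxSynthPendingDepth 3

namespace Vaisman

/-! ### Linear algebra of a unit Lee form at one point -/

section Pointwise

variable {N : ℕ}

/-! The proof compares all connections involved with one connection, `conn`, for which `g`, `J` and
`θ` are parallel; then `U`, `V` and `φ = (1/2) J ∘ π_Q` are parallel as well. It exists because `dω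
= θ ∧ ω` makes the local metrics `e^{-f} g` Kähler, so that `J` is parallel for the Weyl connection
of `(g, θ)` (`fderivJ_weyl`), and because `conn` differs from that connection by endomorphisms
commuting with `J` (`UnitLee.comm_defect`). The torsion of `conn` is `τ(u,v) = 2 g(φu,v) V`.

For every `a`, `defect a` has skew part `τ` and is skew for the deformed metric (`defect_antisymm`,
`deformBil_defect`). Hence `conn - defect a` is torsion-free and metric, so it is the Levi-Civita
connection of the deformed metric. The deformed pair is therefore Vaisman, and its Weyl connection
is `conn + T`, where `T = weylDefect a` is built algebraically from parallel tensors and so is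
parallel. By `affineCurvature_add`, passing from `conn` to `conn + T` changes the curvature only by
the algebraic expression `T(τ(u,v),w) + [T_u, T_v] w`, whose trace is `-(a/4) N g^T` with `g^T = g -
θ ⊗ θ - θ^c ⊗ θ^c` and `N = 2n + 2` (`ricci_weylDefect`).

It remains to find the Ricci tensor of `conn`. Its torsion is parallel and satisfies `τ(τ(u,v),w) =
0`, so the first Bianchi identity and pair symmetry hold as for a Riemannian metric. As `U` and `V`
are parallel, the curvature vanishes as soon as one argument is `U` or `V`. On sections of `Q`,
`conn` is the Bott connection (`bott_eq_affine`), so the hypothesis gives `Ric = κ g^T` with `κ = λ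
+ 1/2` (`sum_curvature_conn`).

Altogether `Ric^D = (κ - aN/4) g^T`. Choosing `a = 4κ/N`, which is positive because `κ` is, makes
`D` Ricci-flat, so the Einstein-Weyl condition holds with `c = 0`. The local potential of the Lee
form comes from the Poincaré lemma (`exists_local_primitive`). -/

/-- A positive definite Hermitian form `g` with a unit covector `θ`, and the vectors `U`, `V` dual to
`θ` and `θ ∘ J`. -/
structure UnitLee (g : Bil N) (J : Rn N →L[ℝ] Rn N) (θ : Rn N →L[ℝ] ℝ) (U V : Rn N) : Prop where
  symm : ∀ u v, g u v = g v u
  pos : ∀ u, u ≠ 0 → 0 < g u u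
  sq : ∀ u, J (J u) = -u
  herm : ∀ u v, g (J u) (J v) = g u v
  dualU : ∀ v, g U v = θ v
  dualV : ∀ v, g V v = θ (J v)
  unit : θ U = 1

/-- The endomorphism `φ = (1/2) J ∘ π_Q`. -/
def phi (J : Rn N →L[ℝ] Rn N) (θ : Rn N →L[ℝ] ℝ) (U V : Rn N) : Rn N →L[ℝ] Rn N :=
  (1 / 2 : ℝ) • (J + θ.smulRight V - (θ.comp J).smulRight U)

/-- The tensor `g(φu,v) V - a (θ^c(u) φv + θ^c(v) φu)`. -/
def defect (a : ℝ) (g : Bil N) (J : Rn N →L[ℝ] Rn N) (θ : Rn N →L[ℝ] ℝ) (U V : Rn N) :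
    Rn N →L[ℝ] Rn N →L[ℝ] Rn N :=
  (ContinuousLinearMap.smulRightL ℝ (Rn N) (Rn N)).flip V ∘L (g ∘L phi J θ U V)
    - a • ((θ.comp J).smulRight (phi J θ U V)
      + ((θ.comp J).smulRight (phi J θ U V)).flip)

/-- The form `a g + (a² - a)(θ ⊗ θ + θ^c ⊗ θ^c)`. -/
def deformBil (a : ℝ) (g : Bil N) (J : Rn N →L[ℝ] Rn N) (θ : Rn N →L[ℝ] ℝ) : Bil N :=
  a • g + (a ^ 2 - a) • (θ.smulRight θ + (θ.comp J).smulRight (θ.comp J))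

lemma phi_apply (J : Rn N →L[ℝ] Rn N) (θ : Rn N →L[ℝ] ℝ) (U V u : Rn N) :
    phi J θ U V u = (1 / 2 : ℝ) • (J u + θ u • V - θ (J u) • U) := rfl

lemma defect_apply (a : ℝ) (g : Bil N) (J : Rn N →L[ℝ] Rn N) (θ : Rn N →L[ℝ] ℝ) (U V u v : Rn N) :
    defect a g J θ U V u v = g (phi J θ U V u) v • V
      - a • (θ (J u) • phi J θ U V v + θ (J v) • phi J θ U V u) := rfl

lemma deformBil_apply (a : ℝ) (g : Bil N) (J : Rn N →L[ℝ] Rn N) (θ : Rn N →L[ℝ] ℝ) (u v : Rn N) :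
    deformBil a g J θ u v = a * g u v + (a ^ 2 - a) * (θ u * θ v + θ (J u) * θ (J v)) := rfl

lemma eq_of_forall_inner {g : Bil N} (pos : ∀ u, u ≠ 0 → 0 < g u u) {u v : Rn N}
    (h : ∀ w, g u w = g v w) : u = v := by
  by_contra hne
  have := pos (u - v) (sub_ne_zero.mpr hne)
  have hz : g (u - v) (u - v) = 0 := by
    rw [show g (u - v) = g u - g v from map_sub g u v, _root_.sub_apply, h, sub_self]
  exact this.ne' hz

namespace UnitLee

variable {g : Bil N} {J : Rn N →L[ℝ] Rn N} {θ : Rn N →L[ℝ] ℝ} {U V : Rn N}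

lemma ext_inner (h : UnitLee g J θ U V) {u v : Rn N} (H : ∀ w, g u w = g v w) : u = v :=
  eq_of_forall_inner h.pos H

lemma skewJ (h : UnitLee g J θ U V) (u v : Rn N) : g (J u) v = -g u (J v) := by
  have := h.herm u (J v)
  rw [h.sq, map_neg] at this
  linarith

lemma innerU (h : UnitLee g J θ U V) (u : Rn N) : g u U = θ u := by rw [h.symm, h.dualU]

lemma innerV (h : UnitLee g J θ U V) (u : Rn N) : g u V = θ (J u) := by rw [h.symm, h.dualV]

lemma JU (h : UnitLee g J θ U V) : J U = -V := by
  refine h.ext_inner fun w => ?_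
  rw [h.skewJ, h.dualU, map_neg, _root_.neg_apply, h.dualV]

lemma JV (h : UnitLee g J θ U V) : J V = U := by
  have := congrArg J h.JU
  rw [h.sq, map_neg] at this
  exact (neg_injective this).symm

lemma leeV (h : UnitLee g J θ U V) : θ V = 0 := by
  have h1 := h.dualU V
  have h2 := h.dualV U
  rw [h.JU, map_neg] at h2
  have := h.symm U V
  linarith

lemma phiU (h : UnitLee g J θ U V) : phi J θ U V U = 0 := by
  rw [phi_apply, h.unit, h.JU, map_neg, h.leeV]; simp

lemma phiV (h : UnitLee g J θ U V) : phi J θ U V V = 0 := by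
  rw [phi_apply, h.JV, h.unit, h.leeV]; simp

lemma lee_phi (h : UnitLee g J θ U V) (u : Rn N) : θ (phi J θ U V u) = 0 := by
  simp [phi_apply, h.unit, h.leeV]

lemma antiLee_phi (h : UnitLee g J θ U V) (u : Rn N) : θ (J (phi J θ U V u)) = 0 := by
  simp [phi_apply, h.unit, h.leeV, h.JU, h.JV, h.sq]

lemma two_inner_phi (h : UnitLee g J θ U V) (u v : Rn N) :
    2 * g (phi J θ U V u) v = g (J u) v + θ u * θ (J v) - θ (J u) * θ v := by
  simp [phi_apply, h.dualU, h.dualV]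

lemma inner_phi_skew (h : UnitLee g J θ U V) (u v : Rn N) :
    g (phi J θ U V u) v = -g (phi J θ U V v) u := by
  have h1 := h.two_inner_phi u v
  have h2 := h.two_inner_phi v u
  have h3 := h.skewJ u v
  have h4 := h.symm u (J v)
  linarith

/-- On `Q` the endomorphism `2φ` is the complex structure, and it kills `U` and `V`; its square is
thus `-π_Q`. -/
lemma four_phi_phi (h : UnitLee g J θ U V) (u : Rn N) :
    (4 : ℝ) • phi J θ U V (phi J θ U V u) = -u + θ u • U + θ (J u) • V := by
  rw [phi_apply (u := phi J θ U V u), h.lee_phi, h.antiLee_phi, phi_apply]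
  simp only [map_smul, map_add, map_sub, h.sq, h.JU, h.JV]
  module

lemma deformBil_symm (h : UnitLee g J θ U V) (a : ℝ) (u v : Rn N) :
    deformBil a g J θ u v = deformBil a g J θ v u := by
  rw [deformBil_apply, deformBil_apply, h.symm u v]; ring

lemma deformBil_herm (h : UnitLee g J θ U V) (a : ℝ) (u v : Rn N) :
    deformBil a g J θ (J u) (J v) = deformBil a g J θ u v := by
  simp only [deformBil_apply, h.herm, h.sq, map_neg]; ring

/-- Cauchy-Schwarz for the unit orthogonal pair `U`, `V`. -/
lemma sq_add_sq_le (h : UnitLee g J θ U V) (u : Rn N) :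
    θ u ^ 2 + θ (J u) ^ 2 ≤ g u u := by
  -- The vector is `π_Q u`; expanding its square norm gives the difference of the two sides.
  have key : 0 ≤ g (u - θ u • U - θ (J u) • V) (u - θ u • U - θ (J u) • V) := by
    by_cases hw : u - θ u • U - θ (J u) • V = 0
    · simp [hw]
    · exact (h.pos _ hw).le
  simp only [map_sub, map_smul, _root_.sub_apply, _root_.smul_apply,
    smul_eq_mul, h.dualU, h.dualV, h.innerU, h.innerV, h.unit, h.leeV, h.JU, h.JV, map_neg] at key
  nlinarith [key]

/-- The deformation scales `Q` by `a` and the plane of `U`, `V` by `a²`. The case split separates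
vectors with no `Q`-component, for which only the second factor counts. -/
lemma deformBil_pos (h : UnitLee g J θ U V) {a : ℝ} (ha : 0 < a) (u : Rn N) (hu : u ≠ 0) :
    0 < deformBil a g J θ u u := by
  rw [deformBil_apply]
  have h1 := h.sq_add_sq_le u
  have h2 := h.pos u hu
  by_cases hz : θ u ^ 2 + θ (J u) ^ 2 = g u u
  · have : a * g u u + (a ^ 2 - a) * (θ u * θ u + θ (J u) * θ (J u)) = a ^ 2 * g u u := by
      rw [← hz]; ring
    rw [this]; positivity
  · have h3 : 0 < g u u - (θ u ^ 2 + θ (J u) ^ 2) := sub_pos.mpr (lt_of_le_of_ne h1 hz)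
    have : a * g u u + (a ^ 2 - a) * (θ u * θ u + θ (J u) * θ (J u)) =
      a * (g u u - (θ u ^ 2 + θ (J u) ^ 2)) + a ^ 2 * (θ u ^ 2 + θ (J u) ^ 2) := by ring
    rw [this]; positivity

/-- The tensor `defect` measures the failure of a connection that leaves the deformed form parallel
to be its Levi-Civita connection. -/
lemma deformBil_defect (h : UnitLee g J θ U V) (a : ℝ) (u v w : Rn N) :
    deformBil a g J θ (defect a g J θ U V u v) w + deformBil a g J θ v (defect a g J θ U V u w)
      = 0 := by
  have h1 := h.inner_phi_skew v w
  have h2 : g v (phi J θ U V u) = g (phi J θ U V u) v := h.symm _ _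
  have h3 : g v (phi J θ U V w) = g (phi J θ U V w) v := h.symm _ _
  simp only [deformBil_apply, defect_apply, map_sub, map_smul, map_add,
    _root_.sub_apply, _root_.smul_apply, _root_.add_apply,
    smul_eq_mul, h.lee_phi, h.antiLee_phi, h.leeV, h.JV, h.unit, h.dualV, h.innerV, h1, h2, h3]
  ring

/-- The right side does not depend on `a`: subtracting `defect a` from `conn` removes the torsion
for every `a` at once. -/
lemma defect_antisymm (h : UnitLee g J θ U V) (a : ℝ) (u v : Rn N) :
    defect a g J θ U V u v - defect a g J θ U V v u = (2 * g (phi J θ U V u) v) • V := by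
  rw [defect_apply, defect_apply, h.inner_phi_skew v u]
  module

end UnitLee

/-- A tensor `B(x,y,z) = g((D_x J) y, z)` with the symmetries coming from `J² = -1`, from the
closedness of the fundamental form and from the vanishing of the Nijenhuis tensor is zero. -/
lemma eq_zero_of_kahler_symmetries {E : Type*} {J : E → E} {B : E → E → E → ℝ} (neg : E → E)
    (sq : ∀ x, J (J x) = neg x) (hneg : ∀ x y z, B x y (neg z) = -B x y z)
    (skew : ∀ x y z, B x y z = -B x z y) (anti : ∀ x y z, B x (J y) z = B x y (J z))
    (cyc : ∀ x y z, B x y z + B y z x + B z x y = 0)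
    (nij : ∀ x y z, B (J x) y z - B (J y) x z + B x y (J z) - B y x (J z) = 0) (x y z : E) :
    B x y z = 0 := by
  -- The left side is symmetric in `x`, `y` by `nij` and skew in `y`, `z` by `sk`; a trilinear
  -- expression with both symmetries is zero.
  have hC : ∀ x y z, B (J x) y z + B x y (J z) = 0 := by
    have sk : ∀ x y z, B (J x) y z + B x y (J z) = -(B (J x) z y + B x z (J y)) := fun x y z => by
      have h1 := skew (J x) y z
      have h2 := anti x z y
      have h3 := skew x (J z) y
      linarith
    intro x y z
    linarith [nij x y z, nij y z x, nij z x y, sk x y z, sk y z x, sk z x y]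
  -- Add the cyclic identities for `(Jx, y, z)` and `(x, y, Jz)`. By `hC` and `anti` everything
  -- cancels except `2 B(y, z, Jx)`.
  have key : ∀ x y z, B y z (J x) = 0 := fun x y z => by
    linarith [cyc (J x) y z, cyc x y (J z), hC x y z, hC z x y, anti y z x, anti z x y,
      anti x y z]
  have := key (J z) x y
  rw [sq, hneg] at this
  linarith

end Pointwise

/-! ### Traces and the algebraic part of the Ricci tensor of the Weyl connection -/

section Trace

variable {N : ℕ}

/-- The trace of an endomorphism of `ℝ^N`, in coordinates. -/
def coordTrace (F : Rn N →L[ℝ] Rn N) : ℝ := ∑ i : Fin N, F (coordVec i) i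

lemma coordTrace_add (F F' : Rn N →L[ℝ] Rn N) :
    coordTrace (F + F') = coordTrace F + coordTrace F' := by
  simp [coordTrace, Finset.sum_add_distrib]

lemma coordTrace_neg (F : Rn N →L[ℝ] Rn N) : coordTrace (-F) = -coordTrace F := by
  simp [coordTrace]

lemma coordTrace_sub (F F' : Rn N →L[ℝ] Rn N) :
    coordTrace (F - F') = coordTrace F - coordTrace F' := by
  simp [coordTrace, Finset.sum_sub_distrib]

lemma coordTrace_smul (c : ℝ) (F : Rn N →L[ℝ] Rn N) :
    coordTrace (c • F) = c * coordTrace F := by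
  simp [coordTrace, Finset.mul_sum]

lemma coordTrace_eq_trace (F : Rn N →L[ℝ] Rn N) :
    coordTrace F = LinearMap.trace ℝ (Rn N) F.toLinearMap := by
  rw [LinearMap.trace_eq_matrix_trace ℝ (EuclideanSpace.basisFun (Fin N) ℝ).toBasis]
  simp [coordTrace, Matrix.trace, LinearMap.toMatrix_apply, coordVec]

lemma coordTrace_smulRight (α : Rn N →L[ℝ] ℝ) (x : Rn N) :
    coordTrace (α.smulRight x) = α x := by
  rw [coordTrace_eq_trace]
  exact LinearMap.trace_smulRight α.toLinearMap x

lemma coordTrace_id : coordTrace (ContinuousLinearMap.id ℝ (Rn N)) = N := by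
  simp [coordTrace, coordVec]

/-- The metric identifies the space with its dual and conjugates `F` into the transpose of `-F`, so
`F` and `-F` have the same trace. -/
lemma coordTrace_eq_zero_of_skew {g : Bil N} (pos : ∀ u, u ≠ 0 → 0 < g u u)
    {F : Rn N →L[ℝ] Rn N} (h : ∀ u v, g (F u) v = -g u (F v)) : coordTrace F = 0 := by
  let B : Rn N →ₗ[ℝ] Module.Dual ℝ (Rn N) :=
    (LinearMap.toContinuousLinearMap (E := Rn N) (F' := ℝ)).symm.toLinearMap ∘ₗ g.toLinearMap
  have hB : Function.Injective B := fun u v huv =>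
    eq_of_forall_inner pos fun w => LinearMap.congr_fun huv w
  let e := LinearEquiv.ofInjectiveOfFinrankEq B hB (Subspace.dual_finrank_eq).symm
  have he : Module.Dual.transpose (R := ℝ) (-F.toLinearMap) = e.conj F.toLinearMap := by
    ext α v
    obtain ⟨u, rfl⟩ := e.surjective α
    have h1 : ∀ x y, e x y = g x y := fun _ _ => rfl
    simp only [LinearEquiv.conj_apply, LinearMap.comp_apply,
      LinearEquiv.coe_coe, LinearEquiv.symm_apply_apply, h1]
    exact (map_neg (g u) (F v)).trans (h u v).symm
  have h2 := LinearMap.trace_transpose' (R := ℝ) (-F.toLinearMap)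
  rw [he, map_neg, LinearMap.trace_conj'] at h2
  rw [coordTrace_eq_trace]
  linarith

/-- The tensor by which the Weyl connection of the deformed pair differs from the connection
leaving the Vaisman structure parallel. -/
def weylDefect (a : ℝ) (g : Bil N) (J : Rn N →L[ℝ] Rn N) (θ : Rn N →L[ℝ] ℝ) (U V : Rn N) :
    Rn N →L[ℝ] Rn N →L[ℝ] Rn N :=
  -defect a g J θ U V
    - (a / 2) • (θ.smulRight (ContinuousLinearMap.id ℝ (Rn N))
      + (θ.smulRight (ContinuousLinearMap.id ℝ (Rn N))).flip)
    + (1 / 2 : ℝ) • ((ContinuousLinearMap.smulRightL ℝ (Rn N) (Rn N)).flip U ∘L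
        (g + (a - 1) • (θ.smulRight θ + (θ.comp J).smulRight (θ.comp J))))

lemma weylDefect_apply (a : ℝ) (g : Bil N) (J : Rn N →L[ℝ] Rn N) (θ : Rn N →L[ℝ] ℝ)
    (U V u v : Rn N) :
    weylDefect a g J θ U V u v = -defect a g J θ U V u v - (a / 2) • (θ u • v + θ v • u)
      + (1 / 2 : ℝ) • ((g u v + (a - 1) * (θ u * θ v + θ (J u) * θ (J v))) • U) := rfl

/-- The transverse form `g - θ ⊗ θ - θ^c ⊗ θ^c`. -/
def transverseForm (g : Bil N) (J : Rn N →L[ℝ] Rn N) (θ : Rn N →L[ℝ] ℝ) (v w : Rn N) : ℝ :=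
  g v w - θ v * θ w - θ (J v) * θ (J w)

namespace UnitLee

variable {g : Bil N} {J : Rn N →L[ℝ] Rn N} {θ : Rn N →L[ℝ] ℝ} {U V : Rn N}

lemma coordTrace_phi (h : UnitLee g J θ U V) : coordTrace (phi J θ U V) = 0 :=
  coordTrace_eq_zero_of_skew h.pos fun u v => by rw [h.inner_phi_skew, h.symm]

lemma coordTrace_phi_phi (h : UnitLee g J θ U V) :
    4 * coordTrace (phi J θ U V ∘L phi J θ U V) = 2 - N := by
  rw [← coordTrace_smul]
  have : (4 : ℝ) • (phi J θ U V ∘L phi J θ U V) =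
      -(ContinuousLinearMap.id ℝ (Rn N)) + θ.smulRight U + (θ.comp J).smulRight V := by
    ext1 u
    exact h.four_phi_phi u
  rw [this, coordTrace_add, coordTrace_add, coordTrace_neg, coordTrace_id, coordTrace_smulRight,
    coordTrace_smulRight, h.unit, ContinuousLinearMap.comp_apply, h.JV, h.unit]
  ring

lemma four_inner_phi_phi (h : UnitLee g J θ U V) (u v : Rn N) :
    4 * g (phi J θ U V (phi J θ U V u)) v = -transverseForm g J θ u v := by
  have := congrArg (fun x => g x v) (h.four_phi_phi u)
  simp only [map_smul, map_add, map_neg, _root_.add_apply, _root_.neg_apply, _root_.smul_apply,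
    smul_eq_mul, h.dualU, h.dualV] at this
  rw [this, transverseForm]; ring

/-- The endomorphism `u ↦ T(u,x)` is a sum of rank-one maps and of multiples of `φ` and the
identity, whose traces are known. The same decomposition is used for the other traces below. -/
lemma coordTrace_weylDefect_flip (h : UnitLee g J θ U V) (a : ℝ) (x : Rn N) :
    coordTrace ((weylDefect a g J θ U V).flip x) = -(a / 2) * N * θ x := by
  have : (weylDefect a g J θ U V).flip x =
      -(((g.flip x).comp (phi J θ U V)).smulRight V)
      + a • ((θ.comp J).smulRight (phi J θ U V x) + θ (J x) • phi J θ U V)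
      - (a / 2) • (θ.smulRight x + θ x • ContinuousLinearMap.id ℝ (Rn N))
      + (1 / 2 : ℝ) •
        ((g.flip x + (a - 1) • (θ x • θ + θ (J x) • θ.comp J)).smulRight U) := by
    ext1 u
    simp only [ContinuousLinearMap.flip_apply, weylDefect_apply, defect_apply, _root_.add_apply,
      _root_.neg_apply, _root_.smul_apply, _root_.sub_apply, ContinuousLinearMap.smulRight_apply,
      ContinuousLinearMap.comp_apply, ContinuousLinearMap.id_apply, smul_eq_mul]
    module
  rw [this]
  simp only [coordTrace_add, coordTrace_sub, coordTrace_neg, coordTrace_smul,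
    coordTrace_smulRight, coordTrace_id, h.coordTrace_phi, ContinuousLinearMap.comp_apply,
    ContinuousLinearMap.flip_apply, h.phiV, h.antiLee_phi, map_zero,
    _root_.add_apply, _root_.smul_apply, smul_eq_mul, h.JU, map_neg, h.leeV, h.unit, h.dualU]
  ring

lemma lee_weylDefect (h : UnitLee g J θ U V) (a : ℝ) (v w : Rn N) :
    θ (weylDefect a g J θ U V v w) =
      (1 / 2) * (transverseForm g J θ v w - a * (θ v * θ w) + a * (θ (J v) * θ (J w))) := by
  simp only [weylDefect_apply, defect_apply, map_add, map_sub, map_neg, map_smul, smul_eq_mul,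
    h.leeV, h.unit, h.lee_phi, transverseForm]
  ring

lemma phi_weylDefect_V (h : UnitLee g J θ U V) (a : ℝ) (w : Rn N) :
    phi J θ U V (weylDefect a g J θ U V V w) = a • phi J θ U V (phi J θ U V w) := by
  simp only [weylDefect_apply, defect_apply, map_add, map_sub, map_neg, map_smul, map_zero,
    h.phiV, h.phiU, h.JV, h.unit, h.leeV]
  module

lemma sum_weylDefect_torsion (h : UnitLee g J θ U V) (a : ℝ) (v w : Rn N) :
    coordTrace (((2 : ℝ) • (g.flip v).comp (phi J θ U V)).smulRight (weylDefect a g J θ U V V w)) =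
      -(a / 2) * transverseForm g J θ v w := by
  have h1 := h.four_inner_phi_phi w v
  have h2 : transverseForm g J θ w v = transverseForm g J θ v w := by
    simp only [transverseForm, h.symm w v]; ring
  rw [coordTrace_smulRight]
  simp only [_root_.smul_apply, ContinuousLinearMap.comp_apply, ContinuousLinearMap.flip_apply,
    h.phi_weylDefect_V, map_smul, smul_eq_mul]
  linear_combination (a / 2) * h1 - a / 2 * h2

/-- `T(v,·)` and `T(·,v)` differ by the rank-one map with image spanned by `V` coming from the
torsion; it is traceless because `g(φv, V) = 0`. -/
lemma coordTrace_weylDefect (h : UnitLee g J θ U V) (a : ℝ) (v : Rn N) :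
    coordTrace (weylDefect a g J θ U V v) = -(a / 2) * N * θ v := by
  have : weylDefect a g J θ U V v = (weylDefect a g J θ U V).flip v
      + ((2 : ℝ) • g (phi J θ U V v)).smulRight (-V) := by
    ext1 u
    have := sub_eq_iff_eq_add.mp (h.defect_antisymm a v u)
    simp only [ContinuousLinearMap.flip_apply, weylDefect_apply, _root_.add_apply,
      _root_.smul_apply, ContinuousLinearMap.smulRight_apply, smul_eq_mul, h.symm u v, this]
    module
  rw [this, coordTrace_add, h.coordTrace_weylDefect_flip, coordTrace_smulRight]
  simp [h.innerV, h.antiLee_phi]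

/-- Expanding `T(u,w)` in `u` leaves rank-one maps, a multiple of `T(v,·)` and a multiple of `T(v,
φ·)`. The last one contains `φ²`, whose trace `(2 - N)/4` enters through `h3`. -/
lemma coordTrace_weylDefect_comp (h : UnitLee g J θ U V) (a : ℝ) (v w : Rn N) :
    coordTrace (weylDefect a g J θ U V v ∘L (weylDefect a g J θ U V).flip w) =
      -(a / 2) * transverseForm g J θ v w + a ^ 2 / 4 * N * (θ v * θ w)
        - a ^ 2 / 4 * N * (θ (J v) * θ (J w)) := by
  set T := weylDefect a g J θ U V with hT
  have hTU : T v U = -(a / 2) • v := by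
    simp only [hT, weylDefect_apply, defect_apply, h.phiU, h.JU, map_neg, h.leeV, h.unit, h.innerU,
      h.lee_phi]
    module
  have hTV : T v V = a • phi J θ U V v - (a / 2 * θ v) • V + (a / 2 * θ (J v)) • U := by
    simp only [hT, weylDefect_apply, defect_apply, h.phiV, h.JV, h.leeV, h.unit, h.innerV,
      h.antiLee_phi]
    module
  have hTphi : T v ∘L phi J θ U V = -((g (phi J θ U V v) ∘L phi J θ U V).smulRight V)
      + (a * θ (J v)) • (phi J θ U V ∘L phi J θ U V) - (a / 2 * θ v) • phi J θ U V
      + (1 / 2 : ℝ) • ((g v).comp (phi J θ U V)).smulRight U := by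
    ext1 u
    simp only [hT, weylDefect_apply, defect_apply, _root_.add_apply,
      _root_.neg_apply, _root_.smul_apply, _root_.sub_apply, ContinuousLinearMap.smulRight_apply,
      ContinuousLinearMap.comp_apply, h.lee_phi, h.antiLee_phi]
    module
  have hcomp : T v ∘L T.flip w =
      -(((g.flip w).comp (phi J θ U V)).smulRight (T v V))
      + a • ((θ.comp J).smulRight (T v (phi J θ U V w)) + θ (J w) • (T v ∘L phi J θ U V))
      - (a / 2) • (θ.smulRight (T v w) + θ w • T v)
      + (1 / 2 : ℝ) •
        ((g.flip w + (a - 1) • (θ w • θ + θ (J w) • θ.comp J)).smulRight (T v U)) := by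
    ext1 u
    have : T u w = -defect a g J θ U V u w - (a / 2) • (θ u • w + θ w • u)
      + (1 / 2 : ℝ) • ((g u w + (a - 1) * (θ u * θ w + θ (J u) * θ (J w))) • U) := rfl
    simp only [ContinuousLinearMap.flip_apply, ContinuousLinearMap.comp_apply, this, defect_apply,
      map_add, map_sub, map_neg, map_smul, _root_.add_apply,
      _root_.neg_apply, _root_.smul_apply, _root_.sub_apply, ContinuousLinearMap.smulRight_apply,
      smul_eq_mul]
    module
  have hJT : θ (J (T v (phi J θ U V w))) = -g (phi J θ U V v) (phi J θ U V w) := by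
    simp only [hT, weylDefect_apply, defect_apply, map_add, map_sub, map_neg, map_smul,
      smul_eq_mul, h.lee_phi, h.antiLee_phi, h.JU, h.JV, h.leeV, h.unit]
    ring
  have h2 : g (phi J θ U V v) (phi J θ U V w) = -g (phi J θ U V (phi J θ U V v)) w := by
    rw [h.inner_phi_skew (phi J θ U V v) w, h.symm]; ring
  have h3 := h.coordTrace_phi_phi
  have h4 : coordTrace (T v) = _ := h.coordTrace_weylDefect a v
  have h5 : θ (T v w) = _ := h.lee_weylDefect a v w
  rw [hcomp, hTphi]
  simp only [coordTrace_add, coordTrace_sub, coordTrace_neg, coordTrace_smul,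
    coordTrace_smulRight, h.coordTrace_phi, ContinuousLinearMap.comp_apply, hTU, hTV, hJT,
    h4, h5, map_add, map_sub, map_smul, h.phiU, h.phiV,
    ContinuousLinearMap.flip_apply, map_zero, _root_.add_apply, _root_.smul_apply,
    smul_eq_mul, h2]
  simp only [transverseForm] at *
  linear_combination a ^ 2 / 4 * θ (J v) * θ (J w) * h3

/-- The quadratic part of the Ricci tensor of the Weyl connection. -/
lemma ricci_weylDefect (h : UnitLee g J θ U V) (a : ℝ) (v w : Rn N) :
    ∑ i : Fin N, (weylDefect a g J θ U V ((2 * g (phi J θ U V (coordVec i)) v) • V) w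
      + weylDefect a g J θ U V (coordVec i) (weylDefect a g J θ U V v w)
      - weylDefect a g J θ U V v (weylDefect a g J θ U V (coordVec i) w)) i =
      -(a / 4) * N * transverseForm g J θ v w := by
  have e : ∀ i : Fin N, weylDefect a g J θ U V ((2 * g (phi J θ U V (coordVec i)) v) • V) w
      + weylDefect a g J θ U V (coordVec i) (weylDefect a g J θ U V v w)
      - weylDefect a g J θ U V v (weylDefect a g J θ U V (coordVec i) w) =
      (((2 : ℝ) • (g.flip v).comp (phi J θ U V)).smulRight (weylDefect a g J θ U V V w)
        + (weylDefect a g J θ U V).flip (weylDefect a g J θ U V v w)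
        - weylDefect a g J θ U V v ∘L (weylDefect a g J θ U V).flip w) (coordVec i) := fun i => by
    rw [map_smul]; rfl
  simp only [e]
  change coordTrace _ = _
  -- The torsion term cancels the dimension-free part of the composition term, and the terms in `θ ⊗
  -- θ` and `θ^c ⊗ θ^c` cancel too; a multiple of the transverse form is left.
  rw [coordTrace_sub, coordTrace_add, h.sum_weylDefect_torsion, h.coordTrace_weylDefect_flip,
    h.coordTrace_weylDefect_comp, h.lee_weylDefect]
  ring

end UnitLee

end Trace

/-! ### Metrics and affine connections in a chart -/

section Koszul

variable {E : Type*} [NormedAddCommGroup E] [NormedSpace ℝ E]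

/-- The bilinear map given by Koszul's formula from the inverse of a metric and the derivative of
the metric. -/
def koszulBil (S : (E →L[ℝ] ℝ) →L[ℝ] E) (D : E →L[ℝ] E →L[ℝ] E →L[ℝ] ℝ) : E →L[ℝ] E →L[ℝ] E :=
  (ContinuousLinearMap.compL ℝ E (E →L[ℝ] ℝ) E S) ∘L
    ((1 / 2 : ℝ) • (D + D.flip
      - (ContinuousLinearMap.flipₗᵢ ℝ E E ℝ).toContinuousLinearEquiv.toContinuousLinearMap ∘L
        D.flip))

lemma contDiffAt_koszulBil {F : Type*} [NormedAddCommGroup F] [NormedSpace ℝ F]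
    {S : F → (E →L[ℝ] ℝ) →L[ℝ] E} {D : F → E →L[ℝ] E →L[ℝ] E →L[ℝ] ℝ} {y : F}
    (hS : ContDiffAt ℝ ∞ S y) (hD : ContDiffAt ℝ ∞ D y) :
    ContDiffAt ℝ ∞ (fun z => koszulBil (S z) (D z)) y := by
  have h3 : ContDiffAt ℝ ∞ (fun z => (D z).flip) y :=
    (ContinuousLinearMap.flipₗᵢ ℝ E E
      (E →L[ℝ] ℝ)).toContinuousLinearEquiv.contDiff.contDiffAt.comp y hD
  exact (((ContinuousLinearMap.compL ℝ E (E →L[ℝ] ℝ) E).contDiff.contDiffAt.comp y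
    hS).clm_comp (((hD.add h3).sub (contDiffAt_const.clm_comp h3)).const_smul (1 / 2 : ℝ)))

lemma infty_add_one_le : (∞ : WithTop ℕ∞) + 1 ≤ ∞ := by norm_cast

lemma natCast_le_infty (k : ℕ) : (k : WithTop ℕ∞) ≤ ∞ := by exact_mod_cast le_top

end Koszul

section Connection

variable {N : ℕ}

lemma isInvertible_of_pos {g : Bil N} (pos : ∀ u, u ≠ 0 → 0 < g u u) : g.IsInvertible := by
  let B : Rn N →ₗ[ℝ] (Rn N →L[ℝ] ℝ) := g.toLinearMap
  have hB : Function.Injective B := fun u v huv =>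
    eq_of_forall_inner pos fun w => congrArg (fun α : Rn N →L[ℝ] ℝ => α w) huv
  have hd : Module.finrank ℝ (Rn N) = Module.finrank ℝ (Rn N →L[ℝ] ℝ) := by
    rw [← (LinearMap.toContinuousLinearMap (𝕜 := ℝ) (E := Rn N) (F' := ℝ)).finrank_eq]
    exact (Subspace.dual_finrank_eq (K := ℝ) (V := Rn N)).symm
  exact ⟨(LinearEquiv.ofInjectiveOfFinrankEq B hB hd).toContinuousLinearEquiv, by ext; rfl⟩

lemma apply_sharp {G : Rn N → Bil N} {y : Rn N} (pos : ∀ u, u ≠ 0 → 0 < G y u u)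
    (α : Rn N →L[ℝ] ℝ) : G y (sharp G y α) = α :=
  (isInvertible_of_pos pos).self_apply_inverse α

lemma contDiffAt_sharp {G : Rn N → Bil N} {α : Rn N → Rn N →L[ℝ] ℝ} {y : Rn N}
    (pos : ∀ u, u ≠ 0 → 0 < G y u u) (hG : ContDiffAt ℝ ∞ G y) (hα : ContDiffAt ℝ ∞ α y) :
    ContDiffAt ℝ ∞ (fun z => sharp G z (α z)) y :=
  ((isInvertible_of_pos pos).contDiffAt_map_inverse.comp y hG).clm_apply hα

/-- The Christoffel map as a continuous bilinear map. -/
def christoffelBil (G : Rn N → Bil N) (y : Rn N) : Rn N →L[ℝ] Rn N →L[ℝ] Rn N :=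
  koszulBil (G y).inverse (fderiv ℝ G y)

lemma christoffelBil_apply (G : Rn N → Bil N) (y u v : Rn N) :
    christoffelBil G y u v = christoffel G y u v := rfl

lemma contDiffAt_christoffelBil {G : Rn N → Bil N} {y : Rn N}
    (pos : ∀ u, u ≠ 0 → 0 < G y u u) (hG : ContDiffAt ℝ ∞ G y) :
    ContDiffAt ℝ ∞ (christoffelBil G) y :=
  contDiffAt_koszulBil ((isInvertible_of_pos pos).contDiffAt_map_inverse.comp y hG)
    (hG.fderiv_right infty_add_one_le)

lemma fderiv_bil_symm {G : Rn N → Bil N} {y : Rn N} (hG : DifferentiableAt ℝ G y)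
    (symm : ∀ᶠ z in 𝓝 y, ∀ u v, G z u v = G z v u) (u v w : Rn N) :
    fderiv ℝ G y u v w = fderiv ℝ G y u w v := by
  have h : ∀ v w, HasFDerivAt (fun z => G z v w) (((fderiv ℝ G y).flip v).flip w) y := fun v w => by
    have := (hG.hasFDerivAt.clm_apply (hasFDerivAt_const v y)).clm_apply (hasFDerivAt_const w y)
    refine this.congr_fderiv ?_
    ext; simp
  have := (h v w).unique ((h w v).congr_of_eventuallyEq (symm.mono fun z hz => hz v w))
  exact congrArg (fun α : Rn N →L[ℝ] ℝ => α u) this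

lemma christoffel_symm {G : Rn N → Bil N} {y : Rn N} (hG : DifferentiableAt ℝ G y)
    (symm : ∀ᶠ z in 𝓝 y, ∀ u v, G z u v = G z v u) (u v : Rn N) :
    christoffel G y u v = christoffel G y v u := by
  unfold christoffel
  congr 2
  ext w
  simp [fderiv_bil_symm hG symm w u v]
  ring

lemma two_inner_christoffel {G : Rn N → Bil N} {y : Rn N} (pos : ∀ u, u ≠ 0 → 0 < G y u u)
    (u v w : Rn N) : 2 * G y (christoffel G y u v) w =
      fderiv ℝ G y u v w + fderiv ℝ G y v u w - fderiv ℝ G y w u v := by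
  unfold christoffel
  rw [apply_sharp pos]
  simp

lemma christoffel_metric {G : Rn N → Bil N} {y : Rn N} (hG : DifferentiableAt ℝ G y)
    (symm : ∀ᶠ z in 𝓝 y, ∀ u v, G z u v = G z v u) (pos : ∀ u, u ≠ 0 → 0 < G y u u)
    (u v w : Rn N) : fderiv ℝ G y u v w =
      G y (christoffel G y u v) w + G y v (christoffel G y u w) := by
  have h1 := two_inner_christoffel pos u v w
  have h2 := two_inner_christoffel pos u w v
  have h3 := symm.self_of_nhds v (christoffel G y u w)
  have h4 := fderiv_bil_symm hG symm u v w
  have h5 := fderiv_bil_symm hG symm v u w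
  have h6 := fderiv_bil_symm hG symm w u v
  linarith

/-- Uniqueness of the torsion-free metric connection at one point; it identifies the Levi-Civita
connection of the deformed metric without inverting that metric. -/
lemma christoffel_unique {G : Rn N → Bil N} {y : Rn N}
    (symm : ∀ u v, G y u v = G y v u) (pos : ∀ u, u ≠ 0 → 0 < G y u u)
    {B : Rn N → Rn N → Rn N} (hB : ∀ u v, B u v = B v u)
    (hmet : ∀ u v w, fderiv ℝ G y u v w = G y (B u v) w + G y v (B u w)) (u v : Rn N) :
    christoffel G y u v = B u v := by
  refine eq_of_forall_inner pos fun w => ?_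
  have h1 := two_inner_christoffel pos u v w
  rw [hmet, hmet, hmet, hB v u, hB w u, hB w v] at h1
  have h2 := symm v (B u w)
  have h3 := symm u (B v w)
  linarith

/-- The curvature of the affine connection with Christoffel map `A`, on constant vectors. -/
def affineCurvature (A : Rn N → Rn N →L[ℝ] Rn N →L[ℝ] Rn N) (y u v w : Rn N) : Rn N :=
  fderiv ℝ A y u v w - fderiv ℝ A y v u w + A y u (A y v w) - A y v (A y u w)

/-- The affine connection with Christoffel map `A`. -/
def affine (A : Rn N → Rn N →L[ℝ] Rn N →L[ℝ] Rn N) (X Y : Rn N → Rn N) (y : Rn N) : Rn N :=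
  fderiv ℝ Y y (X y) + A y (X y) (Y y)

/-- Tensoriality of the curvature: the second derivatives of `Z` cancel by symmetry, and the first
derivatives of `X` and `Y` against the bracket. -/
lemma curvature_affine {A : Rn N → Rn N →L[ℝ] Rn N →L[ℝ] Rn N} {X Y Z : Rn N → Rn N} {y : Rn N}
    (hA : DifferentiableAt ℝ A y) (hX : DifferentiableAt ℝ X y) (hY : DifferentiableAt ℝ Y y)
    (hZ : ContDiffAt ℝ ∞ Z y) :
    curvature (affine A) X Y Z y = affineCurvature A y (X y) (Y y) (Z y) := by
  have hZ1 : DifferentiableAt ℝ Z y := hZ.differentiableAt (by simp)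
  have hZ2 : DifferentiableAt ℝ (fderiv ℝ Z) y :=
    (hZ.fderiv_right infty_add_one_le).differentiableAt (by simp)
  have key : ∀ Y : Rn N → Rn N, DifferentiableAt ℝ Y y → ∀ u, fderiv ℝ (affine A Y Z) y u =
      fderiv ℝ (fderiv ℝ Z) y u (Y y) + fderiv ℝ Z y (fderiv ℝ Y y u)
        + fderiv ℝ A y u (Y y) (Z y) + A y (fderiv ℝ Y y u) (Z y) + A y (Y y) (fderiv ℝ Z y u) := by
    intro Y hY u
    have := (hZ2.hasFDerivAt.clm_apply hY.hasFDerivAt).add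
      ((hA.hasFDerivAt.clm_apply hY.hasFDerivAt).clm_apply hZ1.hasFDerivAt)
    have e : affine A Y Z = (fun z => fderiv ℝ Z z (Y z)) + fun z => A z (Y z) (Z z) := rfl
    rw [e, this.fderiv]
    simp
    abel
  have hs : fderiv ℝ (fderiv ℝ Z) y (X y) (Y y) = fderiv ℝ (fderiv ℝ Z) y (Y y) (X y) :=
    (hZ.isSymmSndFDerivAt (by simpa using natCast_le_infty 2)).eq _ _
  have c : ∀ X W : Rn N → Rn N, affine A X W y = fderiv ℝ W y (X y) + A y (X y) (W y) :=
    fun _ _ => rfl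
  simp only [curvature, c, key X hX, key Y hY, VectorField.lieBracket, map_add, map_sub, hs,
    affineCurvature, _root_.sub_apply]
  abel

end Connection

/-! ### Vaisman structures in a chart -/

section Local

variable {N : ℕ}

/-- The coordinate form of a Vaisman structure with unit Lee form on an open set `O`. -/
structure IsLocalVaisman (O : Set (Rn N)) (G : Rn N → Bil N) (J : Rn N → Rn N →L[ℝ] Rn N)
    (θ : Rn N → Rn N →L[ℝ] ℝ) : Prop where
  isOpen : IsOpen O
  smoothG : ContDiffOn ℝ ∞ G O
  smoothJ : ContDiffOn ℝ ∞ J O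
  smoothLee : ContDiffOn ℝ ∞ θ O
  symm : ∀ y ∈ O, ∀ u v, G y u v = G y v u
  pos : ∀ y ∈ O, ∀ u, u ≠ 0 → 0 < G y u u
  sq : ∀ y ∈ O, ∀ u, J y (J y u) = -u
  herm : ∀ y ∈ O, ∀ u v, G y (J y u) (J y v) = G y u v
  unit : ∀ y ∈ O, θ y (sharp G y (θ y)) = 1
  nij : ∀ y ∈ O, ∀ u v, nijenhuis J (fun _ => u) (fun _ => v) y = 0
  deriv_fundForm : ∀ y ∈ O, ∀ u v w, extDerivTwo (fundForm G J) y u v w =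
    wedgeOneTwo θ (fundForm G J) y u v w
  parallel : ∀ y ∈ O, ∀ u v, nablaForm G θ y u v = 0

/-- The vector field `U = θ^♯`. -/
def leeVec (G : Rn N → Bil N) (θ : Rn N → Rn N →L[ℝ] ℝ) (y : Rn N) : Rn N := sharp G y (θ y)

/-- The vector field `V = (θ ∘ J)^♯`. -/
def antiLeeVec (G : Rn N → Bil N) (J : Rn N → Rn N →L[ℝ] Rn N) (θ : Rn N → Rn N →L[ℝ] ℝ)
    (y : Rn N) : Rn N := sharp G y (antiLee J θ y)

/-- The Christoffel map of the connection that leaves a Vaisman structure with unit Lee form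
parallel and extends the Bott connection. -/
def conn (G : Rn N → Bil N) (J : Rn N → Rn N →L[ℝ] Rn N) (θ : Rn N → Rn N →L[ℝ] ℝ)
    (y : Rn N) : Rn N →L[ℝ] Rn N →L[ℝ] Rn N :=
  christoffelBil G y + defect 1 (G y) (J y) (θ y) (leeVec G θ y) (antiLeeVec G J θ y)

lemma hasFDerivAt_apply_const {E F : Type*} [NormedAddCommGroup E] [NormedSpace ℝ E]
    [NormedAddCommGroup F] [NormedSpace ℝ F] {c : Rn N → E →L[ℝ] F} {y : Rn N}
    (hc : DifferentiableAt ℝ c y) (v : E) :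
    HasFDerivAt (fun z => c z v) ((fderiv ℝ c y).flip v) y := by
  refine (hc.hasFDerivAt.clm_apply (hasFDerivAt_const v y)).congr_fderiv ?_
  ext u; simp

/-- The bracket is the difference between `conn` and the Weyl connection of `(g, θ)`. As it commutes
with `J`, parallelism of `J` passes from the second to the first. -/
lemma UnitLee.comm_defect {g : Bil N} {J : Rn N →L[ℝ] Rn N} {θ : Rn N →L[ℝ] ℝ} {U V : Rn N}
    (h : UnitLee g J θ U V) (u v : Rn N) :
    J (defect 1 g J θ U V u v + (1 / 2 : ℝ) • (θ u • v + θ v • u - g u v • U)) =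
      defect 1 g J θ U V u (J v)
        + (1 / 2 : ℝ) • (θ u • J v + θ (J v) • u - g u (J v) • U) := by
  simp only [defect_apply, phi_apply, map_add, map_sub, map_smul, map_neg, h.sq, h.JU, h.JV,
    h.skewJ, _root_.add_apply, _root_.sub_apply, _root_.smul_apply, smul_eq_mul, h.dualU, h.dualV]
  module

namespace IsLocalVaisman

variable {O : Set (Rn N)} {G : Rn N → Bil N} {J : Rn N → Rn N →L[ℝ] Rn N}
  {θ : Rn N → Rn N →L[ℝ] ℝ} {y : Rn N}

lemma contDiffAtG (h : IsLocalVaisman O G J θ) (hy : y ∈ O) : ContDiffAt ℝ ∞ G y :=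
  h.smoothG.contDiffAt (h.isOpen.mem_nhds hy)

lemma contDiffAtJ (h : IsLocalVaisman O G J θ) (hy : y ∈ O) : ContDiffAt ℝ ∞ J y :=
  h.smoothJ.contDiffAt (h.isOpen.mem_nhds hy)

lemma contDiffAtLee (h : IsLocalVaisman O G J θ) (hy : y ∈ O) : ContDiffAt ℝ ∞ θ y :=
  h.smoothLee.contDiffAt (h.isOpen.mem_nhds hy)

lemma diffG (h : IsLocalVaisman O G J θ) (hy : y ∈ O) : DifferentiableAt ℝ G y :=
  (h.contDiffAtG hy).differentiableAt (by simp)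

lemma diffJ (h : IsLocalVaisman O G J θ) (hy : y ∈ O) : DifferentiableAt ℝ J y :=
  (h.contDiffAtJ hy).differentiableAt (by simp)

lemma diffLee (h : IsLocalVaisman O G J θ) (hy : y ∈ O) : DifferentiableAt ℝ θ y :=
  (h.contDiffAtLee hy).differentiableAt (by simp)

lemma eventually_mem (h : IsLocalVaisman O G J θ) (hy : y ∈ O) : ∀ᶠ z in 𝓝 y, z ∈ O :=
  h.isOpen.mem_nhds hy

lemma unitLee (h : IsLocalVaisman O G J θ) (hy : y ∈ O) :
    UnitLee (G y) (J y) (θ y) (leeVec G θ y) (antiLeeVec G J θ y) where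
  symm := h.symm y hy
  pos := h.pos y hy
  sq := h.sq y hy
  herm := h.herm y hy
  dualU v := by rw [leeVec, apply_sharp (h.pos y hy)]
  dualV v := by rw [antiLeeVec, apply_sharp (h.pos y hy)]; rfl
  unit := h.unit y hy

lemma contDiffAt_antiLee (h : IsLocalVaisman O G J θ) (hy : y ∈ O) :
    ContDiffAt ℝ ∞ (antiLee J θ) y :=
  (h.contDiffAtLee hy).clm_comp (h.contDiffAtJ hy)

lemma contDiffAt_leeVec (h : IsLocalVaisman O G J θ) (hy : y ∈ O) :
    ContDiffAt ℝ ∞ (leeVec G θ) y :=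
  contDiffAt_sharp (h.pos y hy) (h.contDiffAtG hy) (h.contDiffAtLee hy)

lemma contDiffAt_antiLeeVec (h : IsLocalVaisman O G J θ) (hy : y ∈ O) :
    ContDiffAt ℝ ∞ (antiLeeVec G J θ) y :=
  contDiffAt_sharp (h.pos y hy) (h.contDiffAtG hy) (h.contDiffAt_antiLee hy)

lemma christoffelG_symm (h : IsLocalVaisman O G J θ) (hy : y ∈ O) (u v : Rn N) :
    christoffel G y u v = christoffel G y v u :=
  christoffel_symm (h.diffG hy) ((h.eventually_mem hy).mono h.symm) u v

lemma christoffelG_metric (h : IsLocalVaisman O G J θ) (hy : y ∈ O) (u v w : Rn N) :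
    fderiv ℝ G y u v w = G y (christoffel G y u v) w + G y v (christoffel G y u w) :=
  christoffel_metric (h.diffG hy) ((h.eventually_mem hy).mono h.symm) (h.pos y hy) u v w

lemma fderiv_skewJ (h : IsLocalVaisman O G J θ) (hy : y ∈ O) (u v w : Rn N) :
    fderiv ℝ G y u (J y v) w + G y (fderiv ℝ J y u v) w
      + fderiv ℝ G y u v (J y w) + G y v (fderiv ℝ J y u w) = 0 := by
  have h1 : HasFDerivAt (fun z => G z (J z v) w + G z v (J z w)) _ y :=
    (((h.diffG hy).hasFDerivAt.clm_apply (hasFDerivAt_apply_const (h.diffJ hy) v)).clm_apply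
      (hasFDerivAt_const w y)).add
    ((hasFDerivAt_apply_const (h.diffG hy) v).clm_apply (hasFDerivAt_apply_const (h.diffJ hy) w))
  have h2 : HasFDerivAt (fun z => G z (J z v) w + G z v (J z w)) (0 : Rn N →L[ℝ] ℝ) y :=
    (hasFDerivAt_const (0 : ℝ) y).congr_of_eventuallyEq ((h.eventually_mem hy).mono
      fun z hz => by simp [(h.unitLee hz).skewJ])
  have := congrArg (fun α : Rn N →L[ℝ] ℝ => α u) (h1.unique h2)
  simp at this
  linarith

lemma fderiv_sq (h : IsLocalVaisman O G J θ) (hy : y ∈ O) (u v : Rn N) :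
    fderiv ℝ J y u (J y v) = -J y (fderiv ℝ J y u v) := by
  have h1 : HasFDerivAt (fun z => J z (J z v)) _ y :=
    (h.diffJ hy).hasFDerivAt.clm_apply (hasFDerivAt_apply_const (h.diffJ hy) v)
  have h2 : HasFDerivAt (fun z => J z (J z v)) (0 : Rn N →L[ℝ] Rn N) y :=
    (hasFDerivAt_const (-v) y).congr_of_eventuallyEq ((h.eventually_mem hy).mono
      fun z hz => h.sq z hz v)
  have := congrArg (fun α : Rn N →L[ℝ] Rn N => α u) (h1.unique h2)
  simp at this
  exact eq_neg_of_add_eq_zero_right this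

lemma nijenhuis_const (h : IsLocalVaisman O G J θ) (hy : y ∈ O) (u v : Rn N) :
    fderiv ℝ J y (J y u) v - fderiv ℝ J y (J y v) u + J y (fderiv ℝ J y v u)
      - J y (fderiv ℝ J y u v) = 0 := by
  have := h.nij y hy u v
  simp only [nijenhuis, VectorField.lieBracket, (hasFDerivAt_apply_const (h.diffJ hy) _).fderiv,
    fderiv_fun_const, ContinuousLinearMap.flip_apply] at this
  simp at this
  rw [← this]

lemma fderiv_fundForm (h : IsLocalVaisman O G J θ) (hy : y ∈ O) (u v w : Rn N) :
    fderiv ℝ (fun z => fundForm G J z v w) y u =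
      fderiv ℝ G y u v (J y w) + G y v (fderiv ℝ J y u w) := by
  have h1 : HasFDerivAt (fun z => G z v (J z w)) _ y :=
    (hasFDerivAt_apply_const (h.diffG hy) v).clm_apply (hasFDerivAt_apply_const (h.diffJ hy) w)
  have e : (fun z => fundForm G J z v w) = fun z => G z v (J z w) := rfl
  rw [e, h1.fderiv]
  simp [add_comm]

/-- The complex structure is parallel for the Weyl connection. -/
lemma fderivJ_weyl (h : IsLocalVaisman O G J θ) (hy : y ∈ O) {W : Rn N → Rn N → Rn N}
    (hW : ∀ u v, W u v = christoffel G y u v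
      - (1 / 2 : ℝ) • (θ y u • v + θ y v • u - G y u v • leeVec G θ y)) (u v : Rn N) :
    fderiv ℝ J y u v = J y (W u v) - W u (J y v) := by
  have hL := h.unitLee hy
  have hWs : ∀ u v, W u v = W v u := fun u v => by
    rw [hW, hW, h.christoffelG_symm hy u v, hL.symm u v, add_comm (θ y u • v)]
  -- The Weyl connection rescales the metric: `Dg = θ ⊗ g`.
  have hWm : ∀ u v w, fderiv ℝ G y u v w =
      G y (W u v) w + G y v (W u w) + θ y u * G y v w := fun u v w => by
    rw [h.christoffelG_metric hy, hW, hW]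
    simp only [map_add, map_sub, map_smul, _root_.add_apply, _root_.sub_apply, _root_.smul_apply,
      smul_eq_mul, hL.dualU, hL.innerU, hL.symm u w]
    linear_combination (-(1 / 2) * θ y w) * hL.symm u v
  have hWn : ∀ u v, W u (-v) = -W u v := fun u v => by
    rw [hW, hW, ← christoffelBil_apply, ← christoffelBil_apply]
    simp only [map_neg]
    module
  -- Here `B(x,v,z) = g((D_x J) v, z)`. For the cyclic identity, the terms `θ ⊗ g` of `Dg` cancel `θ
  -- ∧ ω`, just as `e^{-f} ω` is closed when `θ = df`.
  have hB := fun w => eq_zero_of_kahler_symmetries (J := J y)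
    (B := fun x v z => G y (fderiv ℝ J y x v + W x (J y v) - J y (W x v)) z) (fun x => -x)
    (h.sq y hy) (fun x v z => map_neg _ _)
    (fun x v z => by
      have h1 := h.fderiv_skewJ hy x v z
      rw [hWm, hWm] at h1
      have h2 := hL.skewJ (W x v) z
      have h3 := hL.skewJ (W x z) v
      have h4 := hL.skewJ v z
      have h5 := hL.symm v (fderiv ℝ J y x z)
      have h6 := hL.symm (J y v) (W x z)
      have h7 := hL.symm v (W x (J y z))
      have h8 := congrArg (fun t => θ y x * t) h4
      simp only [map_add, map_sub, _root_.add_apply, _root_.sub_apply] at *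
      linarith)
    (fun x v z => by
      have h1 := hL.skewJ (fderiv ℝ J y x v + W x (J y v) - J y (W x v)) z
      simp only [map_add, map_sub, _root_.add_apply, _root_.sub_apply, _root_.neg_apply, map_neg,
        h.fderiv_sq hy, hL.sq, hWn] at *
      linarith)
    (fun x v z => by
      have h1 := h.deriv_fundForm y hy x z v
      rw [extDerivTwo, h.fderiv_fundForm hy, h.fderiv_fundForm hy, h.fderiv_fundForm hy, hWm, hWm,
        hWm, hWs x z] at h1
      simp only [wedgeOneTwo, fundForm] at h1
      have k : ∀ x v z, G y (fderiv ℝ J y x v + W x (J y v) - J y (W x v)) z =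
        G y z (fderiv ℝ J y x v) + G y z (W x (J y v)) + G y (W x v) (J y z) := fun x v z => by
        rw [hL.symm z, hL.symm z, ← neg_eq_iff_eq_neg.mpr (hL.skewJ (W x v) z)]
        simp only [map_add, map_sub, _root_.add_apply, _root_.sub_apply]
        ring
      rw [k, k, k, hWs x v, hWs v z]
      linarith)
    (fun x v z => by
      have h1 := congrArg (fun t => G y t z) (h.nijenhuis_const hy x v)
      have h2 := hL.skewJ (fderiv ℝ J y x v + W x (J y v) - J y (W x v)) z
      have h3 := hL.skewJ (fderiv ℝ J y v x + W v (J y x) - J y (W v x)) z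
      simp only [map_add, map_sub, _root_.add_apply, _root_.sub_apply, _root_.neg_apply, map_neg,
        hL.sq, map_zero, _root_.zero_apply] at *
      rw [hWs (J y x) (J y v), hWs (J y x) v, hWs (J y v) x, hWs x v] at *
      linarith) u v w
  have := hL.ext_inner (u := fderiv ℝ J y u v + W u (J y v) - J y (W u v)) (v := 0)
    fun w => by rw [hB w]; simp
  rw [sub_eq_zero] at this
  exact eq_sub_of_add_eq this

lemma conn_apply (y u v : Rn N) : conn G J θ y u v = christoffel G y u v
    + defect 1 (G y) (J y) (θ y) (leeVec G θ y) (antiLeeVec G J θ y) u v := rfl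

/-- Adding `defect 1` keeps `g` parallel because it is skew for `g`, the form `deformBil` at `a =
1`. -/
lemma fderivG (h : IsLocalVaisman O G J θ) (hy : y ∈ O) (u v w : Rn N) :
    fderiv ℝ G y u v w = G y (conn G J θ y u v) w + G y v (conn G J θ y u w) := by
  have h1 := (h.unitLee hy).deformBil_defect 1 u v w
  simp only [deformBil_apply, one_pow, sub_self, zero_mul, add_zero, one_mul] at h1
  rw [h.christoffelG_metric hy, conn_apply, conn_apply]
  simp only [map_add, _root_.add_apply]
  linarith

lemma lee_defect (h : IsLocalVaisman O G J θ) (hy : y ∈ O) (a : ℝ) (u v : Rn N) :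
    θ y (defect a (G y) (J y) (θ y) (leeVec G θ y) (antiLeeVec G J θ y) u v) = 0 := by
  simp [defect_apply, (h.unitLee hy).lee_phi, (h.unitLee hy).leeV]

lemma fderivLee (h : IsLocalVaisman O G J θ) (hy : y ∈ O) (u v : Rn N) :
    fderiv ℝ θ y u v = θ y (conn G J θ y u v) := by
  have := h.parallel y hy u v
  rw [nablaForm, sub_eq_zero] at this
  rw [this, conn_apply, map_add, h.lee_defect hy, add_zero]

lemma fderivJ (h : IsLocalVaisman O G J θ) (hy : y ∈ O) (u v : Rn N) :
    fderiv ℝ J y u v = J y (conn G J θ y u v) - conn G J θ y u (J y v) := by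
  rw [h.fderivJ_weyl hy (fun _ _ => rfl)]
  have := (h.unitLee hy).comm_defect u v
  have e : ∀ v, conn G J θ y u v = (christoffel G y u v
      - (1 / 2 : ℝ) • (θ y u • v + θ y v • u - G y u v • leeVec G θ y))
      + (defect 1 (G y) (J y) (θ y) (leeVec G θ y) (antiLeeVec G J θ y) u v
        + (1 / 2 : ℝ) • (θ y u • v + θ y v • u - G y u v • leeVec G θ y)) := fun v => by
    rw [conn_apply]; abel
  rw [e, e, map_add, this]
  abel

lemma fderiv_antiLee (h : IsLocalVaisman O G J θ) (hy : y ∈ O) (u v : Rn N) :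
    fderiv ℝ (antiLee J θ) y u v = antiLee J θ y (conn G J θ y u v) := by
  have h1 : HasFDerivAt (antiLee J θ) _ y :=
    (h.diffLee hy).hasFDerivAt.clm_comp (h.diffJ hy).hasFDerivAt
  rw [h1.fderiv]
  simp [antiLee, h.fderivLee hy, h.fderivJ hy]

/-- Differentiate `g(α^♯, ·) = α` and use that `g` and `α` are both parallel. -/
lemma fderiv_sharp_of_parallel (h : IsLocalVaisman O G J θ) (hy : y ∈ O)
    {α : Rn N → Rn N →L[ℝ] ℝ} (hα : ContDiffAt ℝ ∞ α y)
    (hpar : ∀ u v, fderiv ℝ α y u v = α y (conn G J θ y u v)) (u : Rn N) :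
    fderiv ℝ (fun z => sharp G z (α z)) y u = -conn G J θ y u (sharp G y (α y)) := by
  have hs : DifferentiableAt ℝ (fun z => sharp G z (α z)) y :=
    (contDiffAt_sharp (h.pos y hy) (h.contDiffAtG hy) hα).differentiableAt (by simp)
  have h1 := (h.diffG hy).hasFDerivAt.clm_apply hs.hasFDerivAt
  have h2 := h1.congr_of_eventuallyEq (f₁ := α) ((h.eventually_mem hy).mono fun z hz =>
    (apply_sharp (h.pos z hz) (α z)).symm)
  refine (h.unitLee hy).ext_inner fun w => ?_
  have h3 := congrArg (fun L : Rn N →L[ℝ] Rn N →L[ℝ] ℝ => L u w) h2.fderiv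
  simp [hpar, h.fderivG hy] at h3
  have h4 : ∀ x, G y (sharp G y (α y)) x = α y x := fun x => by rw [apply_sharp (h.pos y hy)]
  rw [h4] at h3
  simp
  linarith

lemma fderiv_leeVec (h : IsLocalVaisman O G J θ) (hy : y ∈ O) (u : Rn N) :
    fderiv ℝ (leeVec G θ) y u = -conn G J θ y u (leeVec G θ y) :=
  h.fderiv_sharp_of_parallel hy (h.contDiffAtLee hy) (h.fderivLee hy) u

lemma fderiv_antiLeeVec (h : IsLocalVaisman O G J θ) (hy : y ∈ O) (u : Rn N) :
    fderiv ℝ (antiLeeVec G J θ) y u = -conn G J θ y u (antiLeeVec G J θ y) :=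
  h.fderiv_sharp_of_parallel hy (h.contDiffAt_antiLee hy) (h.fderiv_antiLee hy) u

end IsLocalVaisman

end Local

/-! ### Tensors built from parallel tensors -/

section Parallel

variable {N : ℕ}

/-- Along a curve, the derivatives at time `0` of a Vaisman structure that is parallel for a
connection with Christoffel endomorphism `L`. -/
structure ParallelAlong (g : ℝ → Bil N) (J : ℝ → Rn N →L[ℝ] Rn N) (θ : ℝ → Rn N →L[ℝ] ℝ)
    (U V : ℝ → Rn N) (L : Rn N →L[ℝ] Rn N) : Prop where
  bil : ∃ g', HasDerivAt g g' 0 ∧ ∀ v w, g' v w = g 0 (L v) w + g 0 v (L w)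
  endo : ∀ v, HasDerivAt (fun t => J t v) (J 0 (L v) - L (J 0 v)) 0
  lee : ∀ v, HasDerivAt (fun t => θ t v) (θ 0 (L v)) 0
  antiLee : ∀ v, HasDerivAt (fun t => θ t (J t v)) (θ 0 (J 0 (L v))) 0
  leeVec : HasDerivAt U (-L (U 0)) 0
  antiLeeVec : HasDerivAt V (-L (V 0)) 0

namespace ParallelAlong

variable {g : ℝ → Bil N} {J : ℝ → Rn N →L[ℝ] Rn N} {θ : ℝ → Rn N →L[ℝ] ℝ}
  {U V : ℝ → Rn N} {L : Rn N →L[ℝ] Rn N}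

lemma metric (h : ParallelAlong g J θ U V L) (v w : Rn N) :
    HasDerivAt (fun t => g t v w) (g 0 (L v) w + g 0 v (L w)) 0 := by
  obtain ⟨g', hg, hg'⟩ := h.bil
  refine ((hg.clm_apply (hasDerivAt_const 0 v)).clm_apply (hasDerivAt_const 0 w)).congr_deriv ?_
  simp [hg']

/-- In this and the following lemmas, an algebraic expression in parallel tensors is parallel by the
product rule: the derivative of its components is the action of `L` on each slot. Working along a
curve reduces this to one-variable derivatives. -/
lemma phi (h : ParallelAlong g J θ U V L) (v : Rn N) :
    HasDerivAt (fun t => phi (J t) (θ t) (U t) (V t) v)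
      (Vaisman.phi (J 0) (θ 0) (U 0) (V 0) (L v) - L (Vaisman.phi (J 0) (θ 0) (U 0) (V 0) v)) 0 := by
  simp only [phi_apply]
  have := (((h.endo v).add ((h.lee v).smul h.antiLeeVec)).sub
    ((h.antiLee v).smul h.leeVec)).const_smul (1 / 2 : ℝ)
  refine this.congr_deriv ?_
  simp only [map_smul, map_add, map_sub]
  module

lemma inner_phi (h : ParallelAlong g J θ U V L) (v w : Rn N) :
    HasDerivAt (fun t => g t (Vaisman.phi (J t) (θ t) (U t) (V t) v) w)
      (g 0 (Vaisman.phi (J 0) (θ 0) (U 0) (V 0) (L v)) w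
        + g 0 (Vaisman.phi (J 0) (θ 0) (U 0) (V 0) v) (L w)) 0 := by
  obtain ⟨g', hg, hg'⟩ := h.bil
  refine ((hg.clm_apply (h.phi v)).clm_apply (hasDerivAt_const 0 w)).congr_deriv ?_
  simp only [_root_.add_apply, map_sub, _root_.sub_apply, hg', map_zero]
  ring

lemma defect (h : ParallelAlong g J θ U V L) (a : ℝ) (v w : Rn N) :
    HasDerivAt (fun t => defect a (g t) (J t) (θ t) (U t) (V t) v w)
      (Vaisman.defect a (g 0) (J 0) (θ 0) (U 0) (V 0) (L v) w
        + Vaisman.defect a (g 0) (J 0) (θ 0) (U 0) (V 0) v (L w)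
        - L (Vaisman.defect a (g 0) (J 0) (θ 0) (U 0) (V 0) v w)) 0 := by
  simp only [defect_apply]
  have := ((h.inner_phi v w).smul h.antiLeeVec).sub
    ((((h.antiLee v).smul (h.phi w)).add ((h.antiLee w).smul (h.phi v))).const_smul a)
  refine this.congr_deriv ?_
  simp only [map_smul, map_add, map_sub]
  module

lemma weylDefect (h : ParallelAlong g J θ U V L) (a : ℝ) (v w : Rn N) :
    HasDerivAt (fun t => weylDefect a (g t) (J t) (θ t) (U t) (V t) v w)
      (Vaisman.weylDefect a (g 0) (J 0) (θ 0) (U 0) (V 0) (L v) w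
        + Vaisman.weylDefect a (g 0) (J 0) (θ 0) (U 0) (V 0) v (L w)
        - L (Vaisman.weylDefect a (g 0) (J 0) (θ 0) (U 0) (V 0) v w)) 0 := by
  simp only [weylDefect_apply]
  have := ((h.defect a v w).neg.sub
    ((((h.lee v).smul_const w).add ((h.lee w).smul_const v)).const_smul (a / 2))).add
    ((((h.metric v w).add ((((h.lee v).mul (h.lee w)).add
      ((h.antiLee v).mul (h.antiLee w))).const_mul (a - 1))).smul h.leeVec).const_smul (1 / 2 : ℝ))
  refine this.congr_deriv ?_
  simp only [map_smul, map_add, map_sub, map_neg, Pi.add_apply, Pi.mul_apply]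
  module

lemma deformBil (h : ParallelAlong g J θ U V L) (a : ℝ) (v w : Rn N) :
    HasDerivAt (fun t => deformBil a (g t) (J t) (θ t) v w)
      (Vaisman.deformBil a (g 0) (J 0) (θ 0) (L v) w
        + Vaisman.deformBil a (g 0) (J 0) (θ 0) v (L w)) 0 := by
  simp only [deformBil_apply]
  have := ((h.metric v w).const_mul a).add ((((h.lee v).mul (h.lee w)).add
      ((h.antiLee v).mul (h.antiLee w))).const_mul (a ^ 2 - a))
  refine this.congr_deriv ?_
  ring

end ParallelAlong

/-! ### Smooth dependence of the algebraic tensors on the base point. -/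

lemma contDiffAt_smulRight {E F H : Type*} [NormedAddCommGroup E] [NormedSpace ℝ E]
    [NormedAddCommGroup F] [NormedSpace ℝ F] [NormedAddCommGroup H] [NormedSpace ℝ H]
    {α : H → E →L[ℝ] ℝ} {x : H → F} {y : H} (hα : ContDiffAt ℝ ∞ α y) (hx : ContDiffAt ℝ ∞ x y) :
    ContDiffAt ℝ ∞ (fun z => (α z).smulRight (x z)) y :=
  ((ContinuousLinearMap.smulRightL ℝ E F).contDiff.contDiffAt.comp y hα).clm_apply hx

lemma contDiffAt_flip {E F K H : Type*} [NormedAddCommGroup E] [NormedSpace ℝ E]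
    [NormedAddCommGroup F] [NormedSpace ℝ F] [NormedAddCommGroup K] [NormedSpace ℝ K]
    [NormedAddCommGroup H] [NormedSpace ℝ H]
    {B : H → E →L[ℝ] F →L[ℝ] K} {y : H} (hB : ContDiffAt ℝ ∞ B y) :
    ContDiffAt ℝ ∞ (fun z => (B z).flip) y :=
  (ContinuousLinearMap.flipₗᵢ ℝ E F K).toContinuousLinearEquiv.contDiff.contDiffAt.comp y hB

section Smooth

variable {G : Rn N → Bil N} {J : Rn N → Rn N →L[ℝ] Rn N} {θ : Rn N → Rn N →L[ℝ] ℝ}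
  {U V : Rn N → Rn N} {y : Rn N}

lemma contDiffAt_phi (hJ : ContDiffAt ℝ ∞ J y) (hθ : ContDiffAt ℝ ∞ θ y)
    (hU : ContDiffAt ℝ ∞ U y) (hV : ContDiffAt ℝ ∞ V y) :
    ContDiffAt ℝ ∞ (fun z => phi (J z) (θ z) (U z) (V z)) y :=
  ((hJ.add (contDiffAt_smulRight hθ hV)).sub
    (contDiffAt_smulRight (hθ.clm_comp hJ) hU)).const_smul (1 / 2 : ℝ)

lemma contDiffAt_defect (a : ℝ) (hG : ContDiffAt ℝ ∞ G y) (hJ : ContDiffAt ℝ ∞ J y)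
    (hθ : ContDiffAt ℝ ∞ θ y) (hU : ContDiffAt ℝ ∞ U y) (hV : ContDiffAt ℝ ∞ V y) :
    ContDiffAt ℝ ∞ (fun z => defect a (G z) (J z) (θ z) (U z) (V z)) y := by
  have hφ := contDiffAt_phi hJ hθ hU hV
  have h1 := contDiffAt_smulRight (hθ.clm_comp hJ) hφ
  have h2 : ContDiffAt ℝ ∞
      (fun z => (ContinuousLinearMap.smulRightL ℝ (Rn N) (Rn N)).flip (V z)) y :=
    ((ContinuousLinearMap.smulRightL ℝ (Rn N) (Rn N)).flip.contDiff.contDiffAt.comp y hV)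
  exact (h2.clm_comp (hG.clm_comp hφ)).sub ((h1.add (contDiffAt_flip h1)).const_smul a)

lemma contDiffAt_weylDefect (a : ℝ) (hG : ContDiffAt ℝ ∞ G y) (hJ : ContDiffAt ℝ ∞ J y)
    (hθ : ContDiffAt ℝ ∞ θ y) (hU : ContDiffAt ℝ ∞ U y) (hV : ContDiffAt ℝ ∞ V y) :
    ContDiffAt ℝ ∞ (fun z => weylDefect a (G z) (J z) (θ z) (U z) (V z)) y := by
  have h1 := contDiffAt_smulRight hθ (contDiffAt_const (c := ContinuousLinearMap.id ℝ (Rn N)))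
  have h2 : ContDiffAt ℝ ∞
      (fun z => (ContinuousLinearMap.smulRightL ℝ (Rn N) (Rn N)).flip (U z)) y :=
    ((ContinuousLinearMap.smulRightL ℝ (Rn N) (Rn N)).flip.contDiff.contDiffAt.comp y hU)
  have hc := hθ.clm_comp hJ
  exact ((contDiffAt_defect a hG hJ hθ hU hV).neg.sub
    ((h1.add (contDiffAt_flip h1)).const_smul (a / 2))).add
    ((h2.clm_comp (hG.add (((contDiffAt_smulRight hθ hθ).add
      (contDiffAt_smulRight hc hc)).const_smul (a - 1)))).const_smul (1 / 2 : ℝ))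

lemma contDiffAt_deformBil (a : ℝ) (hG : ContDiffAt ℝ ∞ G y) (hJ : ContDiffAt ℝ ∞ J y)
    (hθ : ContDiffAt ℝ ∞ θ y) : ContDiffAt ℝ ∞ (fun z => deformBil a (G z) (J z) (θ z)) y := by
  have hc := hθ.clm_comp hJ
  exact (hG.const_smul a).add (((contDiffAt_smulRight hθ hθ).add
      (contDiffAt_smulRight hc hc)).const_smul (a ^ 2 - a))

end Smooth

lemma hasDerivAt_line {F : Type*} [NormedAddCommGroup F] [NormedSpace ℝ F] {f : Rn N → F}
    {y : Rn N} (hf : DifferentiableAt ℝ f y) (u : Rn N) :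
    HasDerivAt (fun t : ℝ => f (y + t • u)) (fderiv ℝ f y u) 0 :=
  hf.hasFDerivAt.hasLineDerivAt u

lemma hasDerivAt_line_apply {E F : Type*} [NormedAddCommGroup E] [NormedSpace ℝ E]
    [NormedAddCommGroup F] [NormedSpace ℝ F] {f : Rn N → E →L[ℝ] F}
    {y : Rn N} (hf : DifferentiableAt ℝ f y) (u : Rn N) (v : E) :
    HasDerivAt (fun t : ℝ => f (y + t • u) v) (fderiv ℝ f y u v) 0 := by
  have := (hasFDerivAt_apply_const hf v).hasLineDerivAt u
  exact this

lemma hasDerivAt_line_apply₂ {E E' F : Type*} [NormedAddCommGroup E] [NormedSpace ℝ E]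
    [NormedAddCommGroup E'] [NormedSpace ℝ E']
    [NormedAddCommGroup F] [NormedSpace ℝ F] {f : Rn N → E →L[ℝ] E' →L[ℝ] F}
    {y : Rn N} (hf : DifferentiableAt ℝ f y) (u : Rn N) (v : E) (w : E') :
    HasDerivAt (fun t : ℝ => f (y + t • u) v w) (fderiv ℝ f y u v w) 0 := by
  have h1 := hasFDerivAt_apply_const hf v
  have := (hasFDerivAt_apply_const h1.differentiableAt w).hasLineDerivAt u
  rw [h1.fderiv] at this
  exact this

namespace IsLocalVaisman

variable {O : Set (Rn N)} {G : Rn N → Bil N} {J : Rn N → Rn N →L[ℝ] Rn N}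
  {θ : Rn N → Rn N →L[ℝ] ℝ} {y : Rn N}

lemma parallelAlong (h : IsLocalVaisman O G J θ) (hy : y ∈ O) (u : Rn N) :
    ParallelAlong (fun t => G (y + t • u)) (fun t => J (y + t • u)) (fun t => θ (y + t • u))
      (fun t => leeVec G θ (y + t • u)) (fun t => antiLeeVec G J θ (y + t • u))
      (conn G J θ y u) where
  bil := ⟨_, hasDerivAt_line (h.diffG hy) u, by simp [h.fderivG hy]⟩
  endo v := by simpa [h.fderivJ hy] using hasDerivAt_line_apply (h.diffJ hy) u v
  lee v := by simpa [h.fderivLee hy] using hasDerivAt_line_apply (h.diffLee hy) u v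
  antiLee v := by
    have := hasDerivAt_line_apply ((h.contDiffAt_antiLee hy).differentiableAt (by simp)) u v
    rw [h.fderiv_antiLee hy] at this
    simpa [Vaisman.antiLee] using this
  leeVec := by
    simpa [h.fderiv_leeVec hy] using
      hasDerivAt_line ((h.contDiffAt_leeVec hy).differentiableAt (by simp)) u
  antiLeeVec := by
    simpa [h.fderiv_antiLeeVec hy] using
      hasDerivAt_line ((h.contDiffAt_antiLeeVec hy).differentiableAt (by simp)) u

/-- The field of tensors `weylDefect`. -/
abbrev _root_.Vaisman.weylDefectField (a : ℝ) (G : Rn N → Bil N) (J : Rn N → Rn N →L[ℝ] Rn N)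
    (θ : Rn N → Rn N →L[ℝ] ℝ) (z : Rn N) : Rn N →L[ℝ] Rn N →L[ℝ] Rn N :=
  weylDefect a (G z) (J z) (θ z) (leeVec G θ z) (antiLeeVec G J θ z)

lemma contDiffAt_weylDefectField (h : IsLocalVaisman O G J θ) (hy : y ∈ O) (a : ℝ) :
    ContDiffAt ℝ ∞ (weylDefectField a G J θ) y :=
  contDiffAt_weylDefect a (h.contDiffAtG hy) (h.contDiffAtJ hy) (h.contDiffAtLee hy)
    (h.contDiffAt_leeVec hy) (h.contDiffAt_antiLeeVec hy)

lemma contDiffAt_conn (h : IsLocalVaisman O G J θ) (hy : y ∈ O) :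
    ContDiffAt ℝ ∞ (conn G J θ) y :=
  (contDiffAt_christoffelBil (h.pos y hy) (h.contDiffAtG hy)).add
    (contDiffAt_defect 1 (h.contDiffAtG hy) (h.contDiffAtJ hy) (h.contDiffAtLee hy)
    (h.contDiffAt_leeVec hy) (h.contDiffAt_antiLeeVec hy))

lemma fderiv_weylDefectField (h : IsLocalVaisman O G J θ) (hy : y ∈ O) (a : ℝ) (u v w : Rn N) :
    fderiv ℝ (weylDefectField a G J θ) y u v w =
      weylDefectField a G J θ y (conn G J θ y u v) w
        + weylDefectField a G J θ y v (conn G J θ y u w)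
        - conn G J θ y u (weylDefectField a G J θ y v w) := by
  have h1 := hasDerivAt_line_apply₂ ((h.contDiffAt_weylDefectField hy a).differentiableAt
    (by simp)) u v w
  have h2 := h1.unique ((h.parallelAlong hy u).weylDefect a v w)
  simpa using h2

lemma fderiv_deformBil (h : IsLocalVaisman O G J θ) (hy : y ∈ O) (a : ℝ) (u v w : Rn N) :
    fderiv ℝ (fun z => deformBil a (G z) (J z) (θ z)) y u v w =
      deformBil a (G y) (J y) (θ y) (conn G J θ y u v) w
        + deformBil a (G y) (J y) (θ y) v (conn G J θ y u w) := by
  have h1 := hasDerivAt_line_apply₂ ((contDiffAt_deformBil a (h.contDiffAtG hy)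
    (h.contDiffAtJ hy) (h.contDiffAtLee hy)).differentiableAt (by simp)) u v w
  have h2 := h1.unique ((h.parallelAlong hy u).deformBil a v w)
  simpa using h2

end IsLocalVaisman

end Parallel

/-! ### Curvature of the parallelizing connection and of the Weyl connection -/

section Curvature

variable {N : ℕ}

/-- In general the curvature changes by the exterior covariant derivative of `T` plus `[T_u, T_v]`.
For parallel `T` the former is just `T` applied to the torsion of `A`, so no derivative survives. -/
lemma affineCurvature_add {A T : Rn N → Rn N →L[ℝ] Rn N →L[ℝ] Rn N} {y : Rn N}
    (hA : DifferentiableAt ℝ A y) (hT : DifferentiableAt ℝ T y)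
    (hpar : ∀ u v w, fderiv ℝ T y u v w =
      T y (A y u v) w + T y v (A y u w) - A y u (T y v w)) (u v w : Rn N) :
    affineCurvature (fun z => A z + T z) y u v w = affineCurvature A y u v w
      + (T y (A y u v - A y v u) w + T y u (T y v w) - T y v (T y u w)) := by
  have : fderiv ℝ (fun z => A z + T z) y = fderiv ℝ A y + fderiv ℝ T y :=
    (hA.hasFDerivAt.add hT.hasFDerivAt).fderiv
  simp only [affineCurvature, this, _root_.add_apply, hpar, map_add, map_sub, _root_.sub_apply]
  abel

/-- Agreement is required only for the five derivatives that occur, since the Bott connection equals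
the affine one on sections of `Q` but not on all fields. -/
lemma curvature_congr_affine {C : (Rn N → Rn N) → (Rn N → Rn N) → Rn N → Rn N}
    {A : Rn N → Rn N →L[ℝ] Rn N →L[ℝ] Rn N} {X Y Z : Rn N → Rn N} {y : Rn N}
    (hXZ : C X Z =ᶠ[𝓝 y] affine A X Z) (hYZ : C Y Z =ᶠ[𝓝 y] affine A Y Z)
    (hX : C X (C Y Z) y = affine A X (C Y Z) y) (hY : C Y (C X Z) y = affine A Y (C X Z) y)
    (hXY : C (VectorField.lieBracket ℝ X Y) Z y = affine A (VectorField.lieBracket ℝ X Y) Z y) :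
    curvature C X Y Z y = curvature (affine A) X Y Z y := by
  have e1 : affine A X (C Y Z) y = affine A X (affine A Y Z) y := by
    rw [affine, affine, hYZ.fderiv_eq, hYZ.eq_of_nhds]
  have e2 : affine A Y (C X Z) y = affine A Y (affine A X Z) y := by
    rw [affine, affine, hXZ.fderiv_eq, hXZ.eq_of_nhds]
  rw [curvature, curvature, hX, hY, hXY, e1, e2]

lemma ricci_eq_of_affine {C : (Rn N → Rn N) → (Rn N → Rn N) → Rn N → Rn N}
    {A : Rn N → Rn N →L[ℝ] Rn N →L[ℝ] Rn N} {O : Set (Rn N)} {y : Rn N} (hO : IsOpen O)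
    (hy : y ∈ O) (hC : ∀ z ∈ O, ∀ X Y, C X Y z = affine A X Y z) (hA : DifferentiableAt ℝ A y)
    (v w : Rn N) : ricci C y v w = ∑ i : Fin N, affineCurvature A y (coordVec i) v w i := by
  have ev : ∀ X Y, C X Y =ᶠ[𝓝 y] affine A X Y := fun X Y =>
    Filter.eventually_of_mem (hO.mem_nhds hy) fun z hz => hC z hz X Y
  refine Finset.sum_congr rfl fun i _ => ?_
  rw [curvature_congr_affine (ev _ _) (ev _ _) (hC y hy _ _) (hC y hy _ _) (hC y hy _ _),
    curvature_affine hA (differentiableAt_const _) (differentiableAt_const _) contDiffAt_const]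

lemma affineCurvature_skew (A : Rn N → Rn N →L[ℝ] Rn N →L[ℝ] Rn N) (y u v w : Rn N) :
    affineCurvature A y u v w = -affineCurvature A y v u w := by
  simp only [affineCurvature]; abel

lemma affineCurvature_eq_zero_of_parallel {A : Rn N → Rn N →L[ℝ] Rn N →L[ℝ] Rn N}
    {X : Rn N → Rn N} {y : Rn N} (hA : DifferentiableAt ℝ A y) (hX : ContDiffAt ℝ ∞ X y)
    (hpar : ∀ᶠ z in 𝓝 y, ∀ u, fderiv ℝ X z u = -A z u (X z)) (u v : Rn N) :
    affineCurvature A y u v (X y) = 0 := by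
  rw [← curvature_affine (X := fun _ => u) (Y := fun _ => v) hA (differentiableAt_const u)
    (differentiableAt_const v) hX]
  have h0 : ∀ Y : Rn N → Rn N, affine A Y X =ᶠ[𝓝 y] fun _ => 0 := fun Y =>
    hpar.mono fun z hz => by simp [affine, hz]
  have h1 : ∀ Y W : Rn N → Rn N, affine A Y (affine A W X) y = 0 := fun Y W => by
    rw [affine, (h0 W).fderiv_eq, (h0 W).eq_of_nhds]
    simp
  rw [curvature, h1, h1, (h0 _).eq_of_nhds]
  simp

/-- The curvature of a metric connection is skew with respect to the metric. -/
lemma inner_affineCurvature_skew {A : Rn N → Rn N →L[ℝ] Rn N →L[ℝ] Rn N} {G : Rn N → Bil N}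
    {y : Rn N} (hA : DifferentiableAt ℝ A y) (hG : ContDiffAt ℝ ∞ G y)
    (hpar : ∀ᶠ z in 𝓝 y, ∀ u v w, fderiv ℝ G z u v w = G z (A z u v) w + G z v (A z u w))
    (u v w x : Rn N) :
    G y (affineCurvature A y u v w) x + G y w (affineCurvature A y u v x) = 0 := by
  have hG1 : DifferentiableAt ℝ G y := hG.differentiableAt (by simp)
  have hG2 : DifferentiableAt ℝ (fderiv ℝ G) y :=
    (hG.fderiv_right infty_add_one_le).differentiableAt (by simp)
  have hs : ∀ u v, fderiv ℝ (fderiv ℝ G) y u v = fderiv ℝ (fderiv ℝ G) y v u := fun u v =>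
    (hG.isSymmSndFDerivAt (by simpa using natCast_le_infty 2)).eq _ _
  have hAc : ∀ v w, HasFDerivAt (fun z => A z v w) (((fderiv ℝ A y).flip v).flip w) y :=
    fun v w => by
      have h1 := hasFDerivAt_apply_const hA v
      have h2 := hasFDerivAt_apply_const h1.differentiableAt w
      rwa [h1.fderiv] at h2
  -- This is the equation `∇G = 0` differentiated once more; the symmetry `hs` of the second
  -- derivative then gives the claim.
  have key : ∀ u v, fderiv ℝ (fderiv ℝ G) y u v w x =
      G y (A y u (A y v w)) x + G y (A y v w) (A y u x) + G y (fderiv ℝ A y u v w) x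
      + (G y (A y u w) (A y v x) + G y w (A y u (A y v x)) + G y w (fderiv ℝ A y u v x)) := by
    intro u v
    have h1 : HasFDerivAt (fun z => fderiv ℝ G z v w x)
        (((((fderiv ℝ (fderiv ℝ G) y).flip v).flip w)).flip x) y := by
      have h1 := hasFDerivAt_apply_const hG2 v
      have h2 := hasFDerivAt_apply_const h1.differentiableAt w
      have h3 := hasFDerivAt_apply_const h2.differentiableAt x
      rwa [h2.fderiv, h1.fderiv] at h3
    have h2 := (((hG1.hasFDerivAt.clm_apply (hAc v w)).clm_apply (hasFDerivAt_const x y)).add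
      ((hasFDerivAt_apply_const hG1 w).clm_apply (hAc v x)))
    have h3 := h1.unique (h2.congr_of_eventuallyEq (hpar.mono fun z hz => hz v w x))
    have h4 := congrArg (fun α : Rn N →L[ℝ] ℝ => α u) h3
    simp [hpar.self_of_nhds] at h4
    rw [h4]; ring
  have h1 := key u v
  have h2 := key v u
  rw [hs u v] at h1
  simp only [affineCurvature, map_add, map_sub, _root_.add_apply, _root_.sub_apply]
  linarith

/-- The first Bianchi identity for a connection whose torsion `τ` is parallel and satisfies
`τ(τ(u,v),w) = 0`. -/
lemma affineCurvature_cyclic {A τ : Rn N → Rn N →L[ℝ] Rn N →L[ℝ] Rn N} {y : Rn N}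
    (hA : DifferentiableAt ℝ A y)
    (hτ : ∀ᶠ z in 𝓝 y, ∀ u v, A z u v - A z v u = τ z u v)
    (hpar : ∀ u v w, fderiv ℝ τ y u v w =
      τ y (A y u v) w + τ y v (A y u w) - A y u (τ y v w))
    (hττ : ∀ u v w, τ y (τ y u v) w = 0) (u v w : Rn N) :
    affineCurvature A y u v w + affineCurvature A y v w u + affineCurvature A y w u v = 0 := by
  have hd : ∀ u v w, fderiv ℝ A y u v w - fderiv ℝ A y u w v = fderiv ℝ τ y u v w := by
    intro u v w
    have e : τ =ᶠ[𝓝 y] fun z => A z - (A z).flip := hτ.mono fun z hz => by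
      ext1 u; ext1 v; exact (hz u v).symm
    have h1 : HasFDerivAt (fun z => A z - (A z).flip) _ y :=
      hA.hasFDerivAt.sub ((ContinuousLinearMap.flipₗᵢ ℝ (Rn N) (Rn N)
        (Rn N)).toContinuousLinearEquiv.hasFDerivAt.comp y hA.hasFDerivAt)
    rw [e.fderiv_eq, h1.fderiv]
    rfl
  have ht := hτ.self_of_nhds
  have hs : ∀ u v, τ y u v = -τ y v u := fun u v => by rw [← ht, ← ht]; abel
  have e : affineCurvature A y u v w + affineCurvature A y v w u + affineCurvature A y w u v =
      (fderiv ℝ A y u v w - fderiv ℝ A y u w v) + (fderiv ℝ A y v w u - fderiv ℝ A y v u w)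
      + (fderiv ℝ A y w u v - fderiv ℝ A y w v u)
      + A y u (A y v w - A y w v) + A y v (A y w u - A y u w) + A y w (A y u v - A y v u) := by
    simp only [affineCurvature, map_sub]; abel
  rw [e, hd, hd, hd, hpar, hpar, hpar, ht, ht, ht]
  -- Inserting `hpar` cancels the terms in which `A` acts on a value of `τ`. The rest is, up to skew
  -- symmetry, the cyclic sum of `τ(τ(u,v),w)`.
  have c : τ y (A y u v - A y v u) w + τ y (A y v w - A y w v) u + τ y (A y w u - A y u w) v = 0 := by
    rw [ht, ht, ht, hττ, hττ, hττ]; simp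
  simp only [map_sub, _root_.sub_apply] at c
  rw [hs v (A y u w), hs w (A y v u), hs u (A y w v)]
  refine Eq.trans ?_ c
  abel

/-- Pair symmetry of an algebraic curvature tensor. -/
lemma pair_symm_of_cyclic {E : Type*} {R : E → E → E → E → ℝ}
    (h1 : ∀ u v w x, R u v w x = -R v u w x) (h2 : ∀ u v w x, R u v w x = -R u v x w)
    (h3 : ∀ u v w x, R u v w x + R v w u x + R w u v x = 0) (u v w x : E) :
    R u v w x = R w x u v := by
  linarith [h3 u v w x, h3 v w x u, h3 w x u v, h3 x u v w, h1 u v w x, h2 u v w x, h1 v w u x,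
    h2 v w u x, h1 w u v x, h2 w u v x, h1 w x u v, h2 w x u v, h1 x u v w, h2 x u v w,
    h1 x v w u, h2 x v w u, h1 v x w u, h2 v w x u, h2 w x v u, h2 x v w u, h1 u x w v,
    h2 u w x v, h2 u v x w, h2 w u x v, h1 w u x v, h2 x u w v, h1 v x u w, h2 v x u w]

namespace IsLocalVaisman

variable {O : Set (Rn N)} {G : Rn N → Bil N} {J : Rn N → Rn N →L[ℝ] Rn N}
  {θ : Rn N → Rn N →L[ℝ] ℝ} {y : Rn N}

/-- The torsion of the parallelizing connection. -/
def torsion (G : Rn N → Bil N) (J : Rn N → Rn N →L[ℝ] Rn N)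
    (θ : Rn N → Rn N →L[ℝ] ℝ) (z : Rn N) : Rn N →L[ℝ] Rn N →L[ℝ] Rn N :=
  defect 1 (G z) (J z) (θ z) (leeVec G θ z) (antiLeeVec G J θ z)
    - (defect 1 (G z) (J z) (θ z) (leeVec G θ z) (antiLeeVec G J θ z)).flip

lemma conn_sub_conn (h : IsLocalVaisman O G J θ) (hy : y ∈ O) (u v : Rn N) :
    conn G J θ y u v - conn G J θ y v u = torsion G J θ y u v := by
  rw [conn_apply, conn_apply, h.christoffelG_symm hy u v, add_sub_add_left_eq_sub]
  rfl

lemma torsion_apply (h : IsLocalVaisman O G J θ) (hy : y ∈ O) (u v : Rn N) :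
    torsion G J θ y u v = (2 * G y (phi (J y) (θ y) (leeVec G θ y) (antiLeeVec G J θ y) u) v) •
      antiLeeVec G J θ y :=
  (h.unitLee hy).defect_antisymm 1 u v

lemma fderiv_torsion (h : IsLocalVaisman O G J θ) (hy : y ∈ O) (u v w : Rn N) :
    fderiv ℝ (torsion G J θ) y u v w = torsion G J θ y (conn G J θ y u v) w
      + torsion G J θ y v (conn G J θ y u w) - conn G J θ y u (torsion G J θ y v w) := by
  have hd := contDiffAt_defect 1 (h.contDiffAtG hy) (h.contDiffAtJ hy) (h.contDiffAtLee hy)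
    (h.contDiffAt_leeVec hy) (h.contDiffAt_antiLeeVec hy)
  have h1 := hasDerivAt_line_apply₂ ((hd.sub (contDiffAt_flip hd)).differentiableAt
    (by simp)) u v w
  have hp := h.parallelAlong hy u
  have h2 := h1.unique ((hp.defect 1 v w).sub (hp.defect 1 w v))
  refine h2.trans ?_
  simp only [zero_smul, add_zero, torsion, _root_.sub_apply, ContinuousLinearMap.flip_apply, map_sub]
  abel

/-- The torsion takes values in the line of `V`, and `φV = 0`. -/
lemma torsion_torsion (h : IsLocalVaisman O G J θ) (hy : y ∈ O) (u v w : Rn N) :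
    torsion G J θ y (torsion G J θ y u v) w = 0 := by
  rw [h.torsion_apply hy u v, map_smul, _root_.smul_apply, h.torsion_apply hy,
    (h.unitLee hy).phiV]
  simp

lemma diff_conn (h : IsLocalVaisman O G J θ) (hy : y ∈ O) :
    DifferentiableAt ℝ (conn G J θ) y := (h.contDiffAt_conn hy).differentiableAt (by simp)

lemma inner_curvature_pair (h : IsLocalVaisman O G J θ) (hy : y ∈ O) (u v w x : Rn N) :
    G y (affineCurvature (conn G J θ) y u v w) x =
      G y (affineCurvature (conn G J θ) y w x u) v := by
  have ev := h.eventually_mem hy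
  refine pair_symm_of_cyclic (R := fun u v w x => G y (affineCurvature (conn G J θ) y u v w) x)
    (fun u v w x => by rw [affineCurvature_skew]; simp)
    (fun u v w x => ?_) (fun u v w x => ?_) u v w x
  · have := inner_affineCurvature_skew (h.diff_conn hy) (h.contDiffAtG hy)
      (ev.mono fun z hz => h.fderivG hz) u v w x
    rw [h.symm y hy w] at this
    linarith
  · have := affineCurvature_cyclic (h.diff_conn hy)
      (ev.mono fun z hz => h.conn_sub_conn hz) (h.fderiv_torsion hy) (h.torsion_torsion hy) u v w
    have := congrArg (fun t => G y t x) this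
    simpa using this

lemma curvature_leeVec (h : IsLocalVaisman O G J θ) (hy : y ∈ O) (u v : Rn N) :
    affineCurvature (conn G J θ) y u v (leeVec G θ y) = 0 :=
  affineCurvature_eq_zero_of_parallel (h.diff_conn hy) (h.contDiffAt_leeVec hy)
    ((h.eventually_mem hy).mono fun _ hz => h.fderiv_leeVec hz) u v

lemma curvature_antiLeeVec (h : IsLocalVaisman O G J θ) (hy : y ∈ O) (u v : Rn N) :
    affineCurvature (conn G J θ) y u v (antiLeeVec G J θ y) = 0 :=
  affineCurvature_eq_zero_of_parallel (h.diff_conn hy) (h.contDiffAt_antiLeeVec hy)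
    ((h.eventually_mem hy).mono fun _ hz => h.fderiv_antiLeeVec hz) u v

/-- Pair symmetry moves `U` from the first slot to the third, where the curvature vanishes because
`U` is parallel. -/
lemma curvature_leeVec_left (h : IsLocalVaisman O G J θ) (hy : y ∈ O) (v w : Rn N) :
    affineCurvature (conn G J θ) y (leeVec G θ y) v w = 0 :=
  (h.unitLee hy).ext_inner fun x => by
    rw [h.inner_curvature_pair hy, h.curvature_leeVec hy]; simp

lemma curvature_antiLeeVec_left (h : IsLocalVaisman O G J θ) (hy : y ∈ O) (v w : Rn N) :
    affineCurvature (conn G J θ) y (antiLeeVec G J θ y) v w = 0 :=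
  (h.unitLee hy).ext_inner fun x => by
    rw [h.inner_curvature_pair hy, h.curvature_antiLeeVec hy]; simp

lemma curvature_projQ (h : IsLocalVaisman O G J θ) (hy : y ∈ O) (u v w : Rn N) :
    affineCurvature (conn G J θ) y (projQ G J θ y u) v w =
      affineCurvature (conn G J θ) y u v w := by
  have e : affineCurvature (conn G J θ) y (projQ G J θ y u) v w =
      affineCurvature (conn G J θ) y u v w
      - θ y u • affineCurvature (conn G J θ) y (leeVec G θ y) v w
      - antiLee J θ y u • affineCurvature (conn G J θ) y (antiLeeVec G J θ y) v w := by
    simp only [affineCurvature, projQ, leeVec, antiLeeVec, map_sub, map_smul, _root_.sub_apply,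
      _root_.smul_apply]
    module
  rw [e, h.curvature_leeVec_left hy, h.curvature_antiLeeVec_left hy]
  simp

lemma curvature_projQ_mid (h : IsLocalVaisman O G J θ) (hy : y ∈ O) (u v w : Rn N) :
    affineCurvature (conn G J θ) y u (projQ G J θ y v) w =
      affineCurvature (conn G J θ) y u v w := by
  rw [affineCurvature_skew, h.curvature_projQ hy, ← affineCurvature_skew]

lemma curvature_projQ_right (h : IsLocalVaisman O G J θ) (hy : y ∈ O) (u v w : Rn N) :
    affineCurvature (conn G J θ) y u v (projQ G J θ y w) =
      affineCurvature (conn G J θ) y u v w := by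
  have e : affineCurvature (conn G J θ) y u v (projQ G J θ y w) =
      affineCurvature (conn G J θ) y u v w
      - θ y w • affineCurvature (conn G J θ) y u v (leeVec G θ y)
      - antiLee J θ y w • affineCurvature (conn G J θ) y u v (antiLeeVec G J θ y) := by
    simp only [affineCurvature, projQ, leeVec, antiLeeVec, map_sub, map_smul]
    module
  rw [e, h.curvature_leeVec hy, h.curvature_antiLeeVec hy]
  simp

end IsLocalVaisman

end Curvature

/-! ### The Bott connection and the deformed structure -/

section Bott

variable {N : ℕ}

namespace IsLocalVaisman

variable {O : Set (Rn N)} {G : Rn N → Bil N} {J : Rn N → Rn N →L[ℝ] Rn N}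
  {θ : Rn N → Rn N →L[ℝ] ℝ} {y : Rn N}

lemma projQ_def (z u : Rn N) : projQ G J θ z u =
    u - θ z u • leeVec G θ z - antiLee J θ z u • antiLeeVec G J θ z := rfl

lemma lee_projQ (h : IsLocalVaisman O G J θ) (hy : y ∈ O) (u : Rn N) :
    θ y (projQ G J θ y u) = 0 := by
  simp [projQ_def, (h.unitLee hy).unit, (h.unitLee hy).leeV]

lemma antiLee_projQ (h : IsLocalVaisman O G J θ) (hy : y ∈ O) (u : Rn N) :
    antiLee J θ y (projQ G J θ y u) = 0 := by
  simp [projQ_def, antiLee, (h.unitLee hy).unit, (h.unitLee hy).leeV, (h.unitLee hy).JU,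
    (h.unitLee hy).JV]

lemma projQ_eq_self {u : Rn N} (h1 : θ y u = 0) (h2 : antiLee J θ y u = 0) :
    projQ G J θ y u = u := by
  simp [projQ_def, h1, h2]

lemma contDiffAt_projQ (h : IsLocalVaisman O G J θ) (hy : y ∈ O) {X : Rn N → Rn N}
    (hX : ContDiffAt ℝ ∞ X y) : ContDiffAt ℝ ∞ (fun z => projQ G J θ z (X z)) y :=
  (hX.sub (((h.contDiffAtLee hy).clm_apply hX).smul (h.contDiffAt_leeVec hy))).sub
    (((h.contDiffAt_antiLee hy).clm_apply hX).smul (h.contDiffAt_antiLeeVec hy))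

/-- The connection `conn` preserves the kernel of a parallel form. -/
lemma affine_mem_ker {X Y : Rn N → Rn N}
    (hY : DifferentiableAt ℝ Y y) {α : Rn N → Rn N →L[ℝ] ℝ} (hα : DifferentiableAt ℝ α y)
    (hpar : ∀ u v, fderiv ℝ α y u v = α y (conn G J θ y u v))
    (h0 : ∀ᶠ z in 𝓝 y, α z (Y z) = 0) : α y (affine (conn G J θ) X Y y) = 0 := by
  have h1 := hα.hasFDerivAt.clm_apply hY.hasFDerivAt
  have h2 : HasFDerivAt (fun z => α z (Y z)) (0 : Rn N →L[ℝ] ℝ) y :=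
    (hasFDerivAt_const (0 : ℝ) y).congr_of_eventuallyEq h0
  have h3 := congrArg (fun L : Rn N →L[ℝ] ℝ => L (X y)) (h1.unique h2)
  simp only [_root_.add_apply, ContinuousLinearMap.comp_apply, ContinuousLinearMap.flip_apply,
    hpar, _root_.zero_apply] at h3
  rw [affine, map_add]
  exact h3

/-- On sections of `Q` the Bott connection is the restriction of `conn`. -/
lemma bott_eq_affine (h : IsLocalVaisman O G J θ) (hy : y ∈ O) {X Y : Rn N → Rn N}
    (hX : DifferentiableAt ℝ X y) (hY : DifferentiableAt ℝ Y y)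
    (h1 : ∀ᶠ z in 𝓝 y, θ z (Y z) = 0) (h2 : ∀ᶠ z in 𝓝 y, antiLee J θ z (Y z) = 0) :
    bott G J θ X Y y = affine (conn G J θ) X Y y := by
  have hL := h.unitLee hy
  have hcd : DifferentiableAt ℝ (antiLee J θ) y :=
    (h.contDiffAt_antiLee hy).differentiableAt (by simp)
  have hF1 : HasFDerivAt (fun z => θ z (X z) • leeVec G θ z) _ y :=
    ((h.diffLee hy).hasFDerivAt.clm_apply hX.hasFDerivAt).smul
      ((h.contDiffAt_leeVec hy).differentiableAt (by simp)).hasFDerivAt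
  have hF2 : HasFDerivAt (fun z => antiLee J θ z (X z) • antiLeeVec G J θ z) _ y :=
    (hcd.hasFDerivAt.clm_apply hX.hasFDerivAt).smul
      ((h.contDiffAt_antiLeeVec hy).differentiableAt (by simp)).hasFDerivAt
  have hF : HasFDerivAt (fun z => X z - projQ G J θ z (X z)) _ y :=
    (hF1.add hF2).congr_of_eventuallyEq (Filter.Eventually.of_forall fun z => by
      simp only [projQ_def, Pi.add_apply]; abel)
  -- The parallel forms `θ` and `θ^c` annihilate `Y` near the point, hence also its covariant
  -- derivative.
  have hQ : projQ G J θ y (affine (conn G J θ) X Y y) = affine (conn G J θ) X Y y :=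
    projQ_eq_self (affine_mem_ker hY (h.diffLee hy) (h.fderivLee hy) h1)
      (affine_mem_ker hY hcd (h.fderiv_antiLee hy) h2)
  have hU : projQ G J θ y (leeVec G θ y) = 0 := by
    simp [projQ_def, antiLee, hL.unit, hL.JU, hL.leeV]
  have hV : projQ G J θ y (antiLeeVec G J θ y) = 0 := by
    simp [projQ_def, antiLee, hL.unit, hL.JV, hL.leeV]
  have hadd : ∀ u v, projQ G J θ y (u + v) = projQ G J θ y u + projQ G J θ y v := fun u v => by
    simp only [projQ_def, map_add]; module
  have hsm : ∀ (c : ℝ) v, projQ G J θ y (c • v) = c • projQ G J θ y v := fun c v => by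
    simp only [projQ_def, map_smul, smul_eq_mul]; module
  have y2 := h2.self_of_nhds
  have hcU : conn G J θ y (Y y) (leeVec G θ y) = conn G J θ y (leeVec G θ y) (Y y) := by
    have := h.conn_sub_conn hy (leeVec G θ y) (Y y)
    rw [h.torsion_apply hy, hL.phiU] at this
    simp only [map_zero, _root_.zero_apply, mul_zero, zero_smul] at this
    exact (sub_eq_zero.mp this).symm
  have hcV : conn G J θ y (Y y) (antiLeeVec G J θ y) = conn G J θ y (antiLeeVec G J θ y) (Y y) := by
    have := h.conn_sub_conn hy (antiLeeVec G J θ y) (Y y)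
    rw [h.torsion_apply hy, hL.phiV] at this
    simp only [map_zero, _root_.zero_apply, mul_zero, zero_smul] at this
    exact (sub_eq_zero.mp this).symm
  have hdef : defect 1 (G y) (J y) (θ y) (leeVec G θ y) (antiLeeVec G J θ y)
      (projQ G J θ y (X y)) (Y y) = G y (phi (J y) (θ y) (leeVec G θ y) (antiLeeVec G J θ y)
        (projQ G J θ y (X y))) (Y y) • antiLeeVec G J θ y := by
    have a1 : θ y (J y (projQ G J θ y (X y))) = 0 := h.antiLee_projQ hy (X y)
    have a2 : θ y (J y (Y y)) = 0 := y2
    rw [defect_apply, a1, a2]; simp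
  have hchr : christoffel G y (projQ G J θ y (X y)) (Y y) =
      conn G J θ y (projQ G J θ y (X y)) (Y y)
      - G y (phi (J y) (θ y) (leeVec G θ y) (antiLeeVec G J θ y)
        (projQ G J θ y (X y))) (Y y) • antiLeeVec G J θ y := by
    rw [← hdef, conn_apply]; abel
  -- On the `Q`-part of `X` the two connections differ by a multiple of `V`. On the part in the
  -- foliation there is no torsion, so the bracket is the covariant derivative of `Y` minus that of
  -- `θ(X) U + θ^c(X) V`. The projection kills all the extra terms.
  have e : leviCivita G (fun z => projQ G J θ z (X z)) Y y +
      VectorField.lieBracket ℝ (fun z => X z - projQ G J θ z (X z)) Y y =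
      affine (conn G J θ) X Y y
      + (-(G y (phi (J y) (θ y) (leeVec G θ y) (antiLeeVec G J θ y)
        (projQ G J θ y (X y))) (Y y))) • antiLeeVec G J θ y
      + (-(fderiv ℝ θ y (Y y) (X y) + θ y (fderiv ℝ X y (Y y)))) • leeVec G θ y
      + (-(fderiv ℝ (antiLee J θ) y (Y y) (X y) + antiLee J θ y (fderiv ℝ X y (Y y)))) •
        antiLeeVec G J θ y := by
    rw [leviCivita, VectorField.lieBracket, hF.fderiv, hchr, affine]
    simp only [_root_.add_apply, _root_.smul_apply, ContinuousLinearMap.smulRight_apply,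
      ContinuousLinearMap.comp_apply, ContinuousLinearMap.flip_apply, h.fderiv_leeVec hy,
      h.fderiv_antiLeeVec hy, hcU, hcV, projQ_def, map_sub, map_smul, _root_.sub_apply]
    module
  rw [bott, e, hadd, hadd, hadd, hQ, hsm, hsm, hsm, hU, hV]
  simp

/-- The trace over `Q` becomes a full trace because the curvature of `conn` ignores the components
of its first argument along `U` and `V`. -/
lemma transverseRicci_eq (h : IsLocalVaisman O G J θ) (hy : y ∈ O) {v w : Rn N}
    (hv1 : θ y v = 0) (hv2 : antiLee J θ y v = 0) (hw1 : θ y w = 0) (hw2 : antiLee J θ y w = 0) :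
    transverseRicci G J θ y v w =
      ∑ i : Fin N, affineCurvature (conn G J θ) y (coordVec i) v w i := by
  have hO : ∀ᶠ z in 𝓝 y, z ∈ O := h.eventually_mem hy
  have sm : ∀ u, ∀ z ∈ O, ContDiffAt ℝ ∞ (fun z => projQ G J θ z u) z := fun u z hz =>
    h.contDiffAt_projQ hz contDiffAt_const
  have df : ∀ u, ∀ z ∈ O, DifferentiableAt ℝ (fun z => projQ G J θ z u) z := fun u z hz =>
    (sm u z hz).differentiableAt (by simp)
  have q1 : ∀ u : Rn N → Rn N, ∀ z ∈ O, ∀ᶠ x in 𝓝 z, θ x (projQ G J θ x (u x)) = 0 :=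
    fun u z hz => (h.eventually_mem hz).mono fun x hx => h.lee_projQ hx (u x)
  have q2 : ∀ u : Rn N → Rn N, ∀ z ∈ O, ∀ᶠ x in 𝓝 z, antiLee J θ x (projQ G J θ x (u x)) = 0 :=
    fun u z hz => (h.eventually_mem hz).mono fun x hx => h.antiLee_projQ hx (u x)
  have ev : ∀ u u', bott G J θ (fun z => projQ G J θ z u) (fun z => projQ G J θ z u') =ᶠ[𝓝 y]
      affine (conn G J θ) (fun z => projQ G J θ z u) (fun z => projQ G J θ z u') := fun u u' =>
    hO.mono fun z hz => h.bott_eq_affine hz (df u z hz) (df u' z hz)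
      (q1 (fun _ => u') z hz) (q2 (fun _ => u') z hz)
  have dfd : ∀ u, DifferentiableAt ℝ (fderiv ℝ (fun z => projQ G J θ z u)) y := fun u =>
    ((sm u y hy).fderiv_right infty_add_one_le).differentiableAt (by simp)
  have da : ∀ u u', DifferentiableAt ℝ
      (affine (conn G J θ) (fun z => projQ G J θ z u) (fun z => projQ G J θ z u')) y := fun u u' =>
    ((dfd u').clm_apply (df u y hy)).add
      (((h.diff_conn hy).clm_apply (df u y hy)).clm_apply (df u' y hy))
  -- The outer derivative is again taken of a section of `Q`: values of the Bott connection are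
  -- projections by construction.
  have second : ∀ u u' u'', bott G J θ (fun z => projQ G J θ z u)
      (bott G J θ (fun z => projQ G J θ z u') (fun z => projQ G J θ z u'')) y =
      affine (conn G J θ) (fun z => projQ G J θ z u)
      (bott G J θ (fun z => projQ G J θ z u') (fun z => projQ G J θ z u'')) y := fun u u' u'' =>
    h.bott_eq_affine hy (df u y hy) ((da u' u'').congr_of_eventuallyEq (ev u' u''))
      (q1 _ y hy) (q2 _ y hy)
  have dl : ∀ u u', DifferentiableAt ℝ (VectorField.lieBracket ℝ (fun z => projQ G J θ z u)
      (fun z => projQ G J θ z u')) y := fun u u' =>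
    ((dfd u').clm_apply (df u y hy)).sub ((dfd u).clm_apply (df u' y hy))
  refine Finset.sum_congr rfl fun i _ => ?_
  rw [curvature_congr_affine (ev _ _) (ev _ _) (second _ _ _) (second _ _ _)
    (h.bott_eq_affine hy (dl _ _) (df w y hy) (q1 (fun _ => w) y hy) (q2 (fun _ => w) y hy)),
    curvature_affine (h.diff_conn hy) (df _ y hy) (df _ y hy) (sm w y hy), h.curvature_projQ hy,
    projQ_eq_self hv1 hv2, projQ_eq_self hw1 hw2]

/-- The Ricci tensor of `conn` is a multiple of the transverse metric. -/
lemma sum_curvature_conn (h : IsLocalVaisman O G J θ) (hy : y ∈ O) {κ : ℝ}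
    (hKE : ∀ v w, θ y v = 0 → antiLee J θ y v = 0 → θ y w = 0 → antiLee J θ y w = 0 →
      transverseRicci G J θ y v w = κ * G y v w) (v w : Rn N) :
    ∑ i : Fin N, affineCurvature (conn G J θ) y (coordVec i) v w i =
      κ * transverseForm (G y) (J y) (θ y) v w := by
  have h1 := h.lee_projQ hy v
  have h2 := h.antiLee_projQ hy v
  have h3 := h.lee_projQ hy w
  have h4 := h.antiLee_projQ hy w
  have := hKE _ _ h1 h2 h3 h4
  rw [h.transverseRicci_eq hy h1 h2 h3 h4] at this
  -- Arbitrary `v`, `w` are reduced to their `Q`-components, since the curvature ignores the rest;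
  -- on projected vectors `g` becomes the transverse form.
  simp only [h.curvature_projQ_mid hy, h.curvature_projQ_right hy] at this
  rw [this]
  have hL := h.unitLee hy
  congr 1
  simp only [projQ_def, transverseForm, antiLee, ContinuousLinearMap.comp_apply, map_sub, map_smul,
    _root_.sub_apply, _root_.smul_apply, smul_eq_mul, hL.dualU, hL.dualV, hL.innerU, hL.innerV,
    hL.unit, hL.leeV, hL.JU, hL.JV, map_neg]
  ring

/-- The deformed metric in the chart. -/
abbrev _root_.Vaisman.deformMetric (a : ℝ) (G : Rn N → Bil N) (J : Rn N → Rn N →L[ℝ] Rn N)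
    (θ : Rn N → Rn N →L[ℝ] ℝ) (z : Rn N) : Bil N := deformBil a (G z) (J z) (θ z)

lemma christoffel_deformMetric (h : IsLocalVaisman O G J θ) (hy : y ∈ O) {a : ℝ} (ha : 0 < a)
    (u v : Rn N) : christoffel (deformMetric a G J θ) y u v = conn G J θ y u v
      - defect a (G y) (J y) (θ y) (leeVec G θ y) (antiLeeVec G J θ y) u v := by
  have hL := h.unitLee hy
  refine christoffel_unique (G := deformMetric a G J θ) (hL.deformBil_symm a)
    (hL.deformBil_pos ha) (B := fun u v => conn G J θ y u v
      - defect a (G y) (J y) (θ y) (leeVec G θ y) (antiLeeVec G J θ y) u v)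
    (fun u v => ?_) (fun u v w => ?_) u v
  · have h1 := h.conn_sub_conn hy u v
    rw [h.torsion_apply hy, ← hL.defect_antisymm a] at h1
    rw [sub_eq_sub_iff_sub_eq_sub]
    exact h1
  · have h1 := hL.deformBil_defect a u v w
    rw [h.fderiv_deformBil hy]
    simp only [map_sub, _root_.sub_apply]
    linarith

/-- The deformed metric is `a²` times the old one along `U`, so the dual of `aθ` is `a/a²` times
`U`. -/
lemma sharp_deformMetric (h : IsLocalVaisman O G J θ) (hy : y ∈ O) {a : ℝ} (ha : 0 < a) :
    sharp (deformMetric a G J θ) y (a • θ y) = a⁻¹ • leeVec G θ y := by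
  have hL := h.unitLee hy
  refine eq_of_forall_inner (hL.deformBil_pos ha) fun w => ?_
  have := apply_sharp (G := deformMetric a G J θ) (y := y) (hL.deformBil_pos ha) (a • θ y)
  rw [show deformBil a (G y) (J y) (θ y) = deformMetric a G J θ y from rfl, this]
  simp only [deformBil_apply, map_smul, _root_.smul_apply, smul_eq_mul, hL.dualU, hL.unit, hL.JU,
    map_neg, hL.leeV]
  field_simp
  ring

lemma weylConnection_deform (h : IsLocalVaisman O G J θ) (hy : y ∈ O) {a : ℝ} (ha : 0 < a)
    (X Y : Rn N → Rn N) :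
    weylConnection (deformMetric a G J θ) (fun z => a • θ z) X Y y =
      affine (fun z => conn G J θ z + weylDefectField a G J θ z) X Y y := by
  rw [weylConnection, leviCivita, h.christoffel_deformMetric hy ha, h.sharp_deformMetric hy ha,
    affine]
  simp only [_root_.add_apply, weylDefectField, weylDefect_apply, deformMetric, deformBil_apply,
    _root_.smul_apply, smul_eq_mul, smul_smul]
  have : ∀ g t : ℝ, (a * g + (a ^ 2 - a) * t) * a⁻¹ = g + (a - 1) * t := fun g t => by
    field_simp
  rw [this]
  module

lemma _root_.Vaisman.christoffel_congr {G G' : Rn N → Bil N} (hG : G =ᶠ[𝓝 y] G') (u v : Rn N) :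
    christoffel G y u v = christoffel G' y u v := by
  rw [christoffel, christoffel, hG.fderiv_eq, sharp, sharp, hG.eq_of_nhds]

lemma _root_.Vaisman.weylConnection_congr {G G' : Rn N → Bil N} (hG : G =ᶠ[𝓝 y] G')
    (θ : Rn N → Rn N →L[ℝ] ℝ) (X Y : Rn N → Rn N) :
    weylConnection G θ X Y y = weylConnection G' θ X Y y := by
  rw [weylConnection, weylConnection, leviCivita, leviCivita, christoffel_congr hG, sharp, sharp,
    hG.eq_of_nhds]

/-- The Ricci tensor of the Weyl connection of the deformed structure. -/
lemma ricci_deform (h : IsLocalVaisman O G J θ) (hy : y ∈ O) {κ a : ℝ} (ha : 0 < a)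
    {G' : Rn N → Bil N} (hG' : ∀ z ∈ O, G' z = deformMetric a G J θ z)
    (hKE : ∀ v w, θ y v = 0 → antiLee J θ y v = 0 → θ y w = 0 → antiLee J θ y w = 0 →
      transverseRicci G J θ y v w = κ * G y v w) (v w : Rn N) :
    ricci (weylConnection G' (fun z => a • θ z)) y v w =
      (κ - a / 4 * N) * transverseForm (G y) (J y) (θ y) v w := by
  have hT : DifferentiableAt ℝ (weylDefectField a G J θ) y :=
    (h.contDiffAt_weylDefectField hy a).differentiableAt (by simp)
  rw [ricci_eq_of_affine h.isOpen hy (fun z hz X Y => (weylConnection_congr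
    ((h.eventually_mem hz).mono hG') _ X Y).trans (h.weylConnection_deform hz ha X Y))
    ((h.diff_conn hy).add hT)]
  simp only [affineCurvature_add (h.diff_conn hy) hT (h.fderiv_weylDefectField hy a),
    h.conn_sub_conn hy, h.torsion_apply hy]
  have e : ∀ x z : Rn N, ∀ i, (x + z) i = x i + z i := fun _ _ _ => rfl
  simp only [e (affineCurvature _ _ _ _ _)]
  rw [Finset.sum_add_distrib, h.sum_curvature_conn hy hKE, (h.unitLee hy).ricci_weylDefect a v w]
  ring

lemma nablaForm_deform (h : IsLocalVaisman O G J θ) (hy : y ∈ O) {a : ℝ} (ha : 0 < a)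
    {G' : Rn N → Bil N} (hG' : ∀ z ∈ O, G' z = deformMetric a G J θ z)
    (u v : Rn N) : nablaForm G' (fun z => a • θ z) y u v = 0 := by
  have h1 : fderiv ℝ (fun z => a • θ z) y = a • fderiv ℝ θ y :=
    ((h.diffLee hy).hasFDerivAt.const_smul a).fderiv
  rw [nablaForm, christoffel_congr ((h.eventually_mem hy).mono hG'),
    h.christoffel_deformMetric hy ha, h1]
  simp [h.fderivLee hy, h.lee_defect hy]

/-- Since `conn` makes the deformed metric and `J` parallel, the exterior derivative is a cyclic sum
of the fundamental form applied to the torsion. Both sides equal `a² θ ∧ ω` for the original `ω`,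
the terms containing `θ ∧ θ^c` being killed by `θ`. -/
lemma extDerivTwo_deform (h : IsLocalVaisman O G J θ) (hy : y ∈ O) (a : ℝ)
    {G' : Rn N → Bil N} (hG' : ∀ z ∈ O, G' z = deformMetric a G J θ z) (u v w : Rn N) :
    extDerivTwo (fundForm G' J) y u v w =
      wedgeOneTwo (fun z => a • θ z) (fundForm G' J) y u v w := by
  have hL := h.unitLee hy
  have key : ∀ u v w, fderiv ℝ (fun z => fundForm G' J z v w) y u =
      deformBil a (G y) (J y) (θ y) (conn G J θ y u v) (J y w)
      + deformBil a (G y) (J y) (θ y) v (J y (conn G J θ y u w)) := by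
    intro u v w
    have hd : DifferentiableAt ℝ (deformMetric a G J θ) y := (contDiffAt_deformBil a
      (h.contDiffAtG hy) (h.contDiffAtJ hy) (h.contDiffAtLee hy)).differentiableAt (by simp)
    have h1 : HasFDerivAt (fun z => deformMetric a G J θ z v (J z w)) _ y :=
      (hasFDerivAt_apply_const hd v).clm_apply (hasFDerivAt_apply_const (h.diffJ hy) w)
    have e : (fun z => fundForm G' J z v w) =ᶠ[𝓝 y] fun z => deformMetric a G J θ z v (J z w) :=
      (h.eventually_mem hy).mono fun z hz => by
        change G' z v (J z w) = _
        rw [hG' z hz]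
    rw [e.fderiv_eq, h1.fderiv]
    simp only [_root_.add_apply, ContinuousLinearMap.comp_apply, ContinuousLinearMap.flip_apply,
      h.fderiv_deformBil hy, h.fderivJ hy, map_sub]
    ring
  have skew : ∀ u v, deformBil a (G y) (J y) (θ y) u (J y v) =
      -deformBil a (G y) (J y) (θ y) (J y u) v := fun u v => by
    rw [← hL.deformBil_herm a u (J y v), hL.sq, map_neg]
  have tor : ∀ u v w, deformBil a (G y) (J y) (θ y) (conn G J θ y u v) (J y w)
      - deformBil a (G y) (J y) (θ y) (conn G J θ y v u) (J y w) =
      -(a ^ 2 * (2 * G y (phi (J y) (θ y) (leeVec G θ y) (antiLeeVec G J θ y) u) v) * θ y w) := by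
    intro u v w
    rw [← _root_.sub_apply, ← map_sub, h.conn_sub_conn hy, h.torsion_apply hy, map_smul,
      _root_.smul_apply, deformBil_apply, hL.dualV, hL.leeV, hL.JV, hL.sq, hL.unit]
    simp only [map_neg, smul_eq_mul]
    ring
  have sw : ∀ u v w, deformBil a (G y) (J y) (θ y) v (J y (conn G J θ y u w)) =
      -deformBil a (G y) (J y) (θ y) (conn G J θ y u w) (J y v) := fun u v w => by
    rw [skew, hL.deformBil_symm]
  rw [extDerivTwo, key, key, key, sw, sw, sw]
  have t1 := tor u v w
  have t2 := tor v w u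
  have t3 := tor w u v
  rw [hL.two_inner_phi] at t1 t2 t3
  simp only [wedgeOneTwo, fundForm, hG' y hy, deformMetric, skew w u, skew u v,
    skew v w, deformBil_apply, hL.sq, _root_.smul_apply, smul_eq_mul, map_neg] at *
  linarith

end IsLocalVaisman

end Bott

/-! ### Smooth sections and their coordinate expressions -/

section Charts

variable {N : ℕ} {M : Type*} [TopologicalSpace M] [ChartedSpace (Rn N) M]
  [IsManifold 𝓘(ℝ, Rn N) ∞ M]

lemma chartDeriv_chartInvDeriv (p : M) {y : Rn N} (hy : y ∈ (chartAt (Rn N) p).target) (v : Rn N) :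
    chartDeriv p y (chartInvDeriv p y v) = v := by
  have h := (mdifferentiable_chart (I := 𝓘(ℝ, Rn N)) p).comp_symm_deriv hy
  exact congrArg (fun L : Rn N →L[ℝ] Rn N => L v) h

lemma chartInvDeriv_chartDeriv (p : M) {y : Rn N} (hy : y ∈ (chartAt (Rn N) p).target)
    (v : TangentSpace 𝓘(ℝ, Rn N) ((chartAt (Rn N) p).symm y)) :
    chartInvDeriv p y (chartDeriv p y v) = v := by
  have h := (mdifferentiable_chart (I := 𝓘(ℝ, Rn N)) p).symm_comp_deriv
    ((chartAt (Rn N) p).map_target hy)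
  rw [(chartAt (Rn N) p).right_inv hy] at h
  exact congrArg (fun L : Rn N →L[ℝ] Rn N => L v) h

lemma symmL_eq_chartInvDeriv (p : M) {y : Rn N} (hy : y ∈ (chartAt (Rn N) p).target) :
    (trivializationAt (Rn N) (TangentSpace 𝓘(ℝ, Rn N)) p).symmL ℝ ((chartAt (Rn N) p).symm y) =
      chartInvDeriv p y := by
  rw [TangentBundle.symmL_trivializationAt ((chartAt (Rn N) p).map_target hy)]
  have : extChartAt 𝓘(ℝ, Rn N) p ((chartAt (Rn N) p).symm y) = y := by
    simp [(chartAt (Rn N) p).right_inv hy]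
  rw [this]
  simp [chartInvDeriv, mfderivWithin_univ]
  rfl

lemma continuousLinearMapAt_eq_chartDeriv (p : M) {y : Rn N} (hy : y ∈ (chartAt (Rn N) p).target) :
    (trivializationAt (Rn N) (TangentSpace 𝓘(ℝ, Rn N)) p).continuousLinearMapAt ℝ
      ((chartAt (Rn N) p).symm y) = chartDeriv p y := by
  rw [TangentBundle.continuousLinearMapAt_trivializationAt ((chartAt (Rn N) p).map_target hy)]
  simp [chartDeriv]
  rfl

lemma trivialization_covector (p : M) {y : Rn N} (hy : y ∈ (chartAt (Rn N) p).target)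
    (α : TangentSpace 𝓘(ℝ, Rn N) ((chartAt (Rn N) p).symm y) →L[ℝ] ℝ) :
    (trivializationAt (Rn N →L[ℝ] ℝ) (fun x : M => TangentSpace 𝓘(ℝ, Rn N) x →L[ℝ] ℝ) p
      ⟨(chartAt (Rn N) p).symm y, α⟩).2 = α.comp (chartInvDeriv p y) := by
  rw [hom_trivializationAt_apply]
  change ((trivializationAt ℝ (fun _ : M => ℝ) p).continuousLinearMapAt ℝ _) ∘L (α ∘L
    (trivializationAt (Rn N) (TangentSpace 𝓘(ℝ, Rn N)) p).symmL ℝ ((chartAt (Rn N) p).symm y)) = _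
  rw [symmL_eq_chartInvDeriv p hy]
  ext v
  simp

lemma trivialization_endo (p : M) {y : Rn N} (hy : y ∈ (chartAt (Rn N) p).target)
    (F : TangentSpace 𝓘(ℝ, Rn N) ((chartAt (Rn N) p).symm y) →L[ℝ]
      TangentSpace 𝓘(ℝ, Rn N) ((chartAt (Rn N) p).symm y)) :
    (trivializationAt (Rn N →L[ℝ] Rn N)
      (fun x : M => TangentSpace 𝓘(ℝ, Rn N) x →L[ℝ] TangentSpace 𝓘(ℝ, Rn N) x) p
      ⟨(chartAt (Rn N) p).symm y, F⟩).2 = ((chartDeriv p y).comp F).comp (chartInvDeriv p y) := by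
  rw [hom_trivializationAt_apply]
  change (trivializationAt (Rn N) (TangentSpace 𝓘(ℝ, Rn N)) p).continuousLinearMapAt ℝ
      ((chartAt (Rn N) p).symm y) ∘L (F ∘L
    (trivializationAt (Rn N) (TangentSpace 𝓘(ℝ, Rn N)) p).symmL ℝ ((chartAt (Rn N) p).symm y)) = _
  rw [symmL_eq_chartInvDeriv p hy, continuousLinearMapAt_eq_chartDeriv p hy]
  rfl

lemma trivialization_bil (p : M) {y : Rn N} (hy : y ∈ (chartAt (Rn N) p).target)
    (b : TangentSpace 𝓘(ℝ, Rn N) ((chartAt (Rn N) p).symm y) →L[ℝ]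
      TangentSpace 𝓘(ℝ, Rn N) ((chartAt (Rn N) p).symm y) →L[ℝ] ℝ) :
    (trivializationAt (Rn N →L[ℝ] Rn N →L[ℝ] ℝ)
      (fun x : M => TangentSpace 𝓘(ℝ, Rn N) x →L[ℝ] TangentSpace 𝓘(ℝ, Rn N) x →L[ℝ] ℝ) p
      ⟨(chartAt (Rn N) p).symm y, b⟩).2 =
    (ContinuousLinearMap.precomp ℝ (chartInvDeriv p y)).comp (b.comp (chartInvDeriv p y)) := by
  have hx := (chartAt (Rn N) p).map_target hy
  rw [hom_trivializationAt_apply]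
  change (trivializationAt (Rn N →L[ℝ] ℝ)
    (fun x : M => TangentSpace 𝓘(ℝ, Rn N) x →L[ℝ] ℝ) p).continuousLinearMapAt ℝ
      ((chartAt (Rn N) p).symm y) ∘L (b ∘L
    (trivializationAt (Rn N) (TangentSpace 𝓘(ℝ, Rn N)) p).symmL ℝ ((chartAt (Rn N) p).symm y)) = _
  rw [symmL_eq_chartInvDeriv p hy]
  ext1 v
  have hb : (chartAt (Rn N) p).symm y ∈ (trivializationAt (Rn N →L[ℝ] ℝ)
    (fun x : M => TangentSpace 𝓘(ℝ, Rn N) x →L[ℝ] ℝ) p).baseSet := ⟨hx, by trivial⟩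
  refine Eq.trans ?_ (trivialization_covector p hy (b (chartInvDeriv p y v)))
  exact congrArg (fun L => L (b (chartInvDeriv p y v)))
    (Bundle.Trivialization.coe_linearMapAt_of_mem (R := ℝ) _ hb)

lemma contMDiffOn_source_iff {F : Type*} [NormedAddCommGroup F] [NormedSpace ℝ F] (p : M)
    {f : M → F} {f' : Rn N → F}
    (hf : ∀ y ∈ (chartAt (Rn N) p).target, f ((chartAt (Rn N) p).symm y) = f' y) :
    ContMDiffOn 𝓘(ℝ, Rn N) 𝓘(ℝ, F) ∞ f (chartAt (Rn N) p).source ↔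
      ContDiffOn ℝ ∞ f' (chartAt (Rn N) p).target := by
  rw [← contMDiffOn_iff_contDiffOn]
  constructor
  · intro h
    have := h.comp (contMDiffOn_chart_symm (I := 𝓘(ℝ, Rn N)) (x := p) (n := ∞))
      fun y hy => (chartAt (Rn N) p).map_target hy
    exact this.congr fun y hy => (hf y hy).symm
  · intro h
    have := h.comp (contMDiffOn_chart (I := 𝓘(ℝ, Rn N)) (x := p) (n := ∞))
      fun x hx => (chartAt (Rn N) p).map_source hx
    refine this.congr fun x hx => ?_
    rw [Function.comp_apply, ← hf _ ((chartAt (Rn N) p).map_source hx),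
      (chartAt (Rn N) p).left_inv hx]

section

variable {F : Type*} [NormedAddCommGroup F] [NormedSpace ℝ F] {E : M → Type*}
  [∀ x, AddCommGroup (E x)] [∀ x, Module ℝ (E x)] [TopologicalSpace (Bundle.TotalSpace F E)]
  [∀ x, TopologicalSpace (E x)] [FiberBundle F E] [VectorBundle ℝ F E]
  [ContMDiffVectorBundle ∞ F E 𝓘(ℝ, Rn N)]

/-- Smoothness of a section is local, and over a chart domain the trivialization and the chart turn
it into smoothness of a map between normed spaces. The hypothesis `hb` lets the two domains be
identified. -/
lemma contMDiff_section_iff_inChart (s : (x : M) → E x) (s' : M → Rn N → F)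
    (hb : ∀ p, (trivializationAt F E p).baseSet = (chartAt (Rn N) p).source)
    (hs : ∀ p, ∀ y ∈ (chartAt (Rn N) p).target,
      (trivializationAt F E p ⟨(chartAt (Rn N) p).symm y, s ((chartAt (Rn N) p).symm y)⟩).2 =
        s' p y) :
    ContMDiff 𝓘(ℝ, Rn N) (𝓘(ℝ, Rn N).prod 𝓘(ℝ, F)) ∞
      (fun x => Bundle.TotalSpace.mk' F (E := E) x (s x)) ↔
      ∀ p, ContDiffOn ℝ ∞ (s' p) (chartAt (Rn N) p).target := by
  have key : ∀ p, ContMDiffOn 𝓘(ℝ, Rn N) (𝓘(ℝ, Rn N).prod 𝓘(ℝ, F)) ∞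
      (fun x => Bundle.TotalSpace.mk' F (E := E) x (s x)) (chartAt (Rn N) p).source ↔
      ContDiffOn ℝ ∞ (s' p) (chartAt (Rn N) p).target := fun p => by
    rw [← hb p, (trivializationAt F E p).contMDiffOn_section_baseSet_iff, hb p]
    exact contMDiffOn_source_iff p (hs p)
  constructor
  · intro h p
    exact (key p).mp h.contMDiffOn
  · intro h x
    exact ((key x).mpr (h x)).contMDiffAt
      ((chartAt (Rn N) x).open_source.mem_nhds (mem_chart_source _ x))

end

lemma smoothCovector_iff (θ : CovectorField N M) :
    SmoothCovector θ ↔ ∀ p, ContDiffOn ℝ ∞ (covInChart θ p) (chartAt (Rn N) p).target :=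
  contMDiff_section_iff_inChart _ _ (fun _ => Set.inter_univ _)
    fun p _ hy => trivialization_covector p hy _

lemma smoothEndo_iff (J : EndoField N M) :
    SmoothEndo J ↔ ∀ p, ContDiffOn ℝ ∞ (endoInChart J p) (chartAt (Rn N) p).target :=
  contMDiff_section_iff_inChart _ _ (fun _ => Set.inter_self _)
    fun p _ hy => trivialization_endo p hy _

lemma smoothBil_iff (b : (x : M) → TangentSpace 𝓘(ℝ, Rn N) x →L[ℝ]
      TangentSpace 𝓘(ℝ, Rn N) x →L[ℝ] ℝ) :
    ContMDiff 𝓘(ℝ, Rn N) (𝓘(ℝ, Rn N).prod 𝓘(ℝ, Rn N →L[ℝ] Rn N →L[ℝ] ℝ)) ∞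
      (fun x => Bundle.TotalSpace.mk' (Rn N →L[ℝ] Rn N →L[ℝ] ℝ)
        (E := fun x : M => TangentSpace 𝓘(ℝ, Rn N) x →L[ℝ] TangentSpace 𝓘(ℝ, Rn N) x →L[ℝ] ℝ)
        x (b x)) ↔
      ∀ p, ContDiffOn ℝ ∞ (fun y => (ContinuousLinearMap.precomp ℝ (chartInvDeriv p y)).comp
        ((b ((chartAt (Rn N) p).symm y)).comp (chartInvDeriv p y)) : Rn N → Bil N)
        (chartAt (Rn N) p).target :=
  contMDiff_section_iff_inChart _ _
    (fun _ => (congrArg _ (Set.inter_univ _)).trans (Set.inter_self _))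
    fun p _ hy => trivialization_bil p hy _

end Charts

/-! ### The deformed structure on the manifold -/

section Global

variable {N : ℕ} {M : Type*} [TopologicalSpace M] [ChartedSpace (Rn N) M]

lemma covInChart_apply (θ : CovectorField N M) (p : M) (y u : Rn N) :
    covInChart θ p y u = θ ((chartAt (Rn N) p).symm y) (chartInvDeriv p y u) := rfl

lemma endoInChart_apply (J : EndoField N M) (p : M) (y u : Rn N) : endoInChart J p y u =
    chartDeriv p y (J ((chartAt (Rn N) p).symm y) (chartInvDeriv p y u)) := rfl

variable [IsManifold 𝓘(ℝ, Rn N) ∞ M] {J : EndoField N M} {g : Metric N M} {θ : CovectorField N M}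

lemma metricInChart_apply (g : Metric N M) (p : M) (y u v : Rn N) :
    metricInChart g p y u v = g.inner ((chartAt (Rn N) p).symm y) (chartInvDeriv p y u)
      (chartInvDeriv p y v) := rfl

lemma chartInvDeriv_endoInChart (J : EndoField N M) (p : M) {y : Rn N}
    (hy : y ∈ (chartAt (Rn N) p).target) (u : Rn N) : chartInvDeriv p y (endoInChart J p y u) =
      J ((chartAt (Rn N) p).symm y) (chartInvDeriv p y u) := by
  rw [endoInChart_apply, chartInvDeriv_chartDeriv p hy]

/-- Each tangent space is a copy of the model space, so the pointwise linear algebra applies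
directly to the fibers. -/
lemma unitLee_fiber (hV : IsVaisman J g θ) (hθ : ∀ x, normSq g θ x = 1) (x : M) :
    UnitLee (N := N) (g.inner x) (J x) (θ x) ((g.inner x).inverse (θ x))
      ((g.inner x).inverse ((θ x).comp (J x))) := by
  have hinv : ContinuousLinearMap.IsInvertible (g.inner x : Bil N) := isInvertible_of_pos (g.pos x)
  exact {
    symm := g.symm x
    pos := g.pos x
    sq := hV.complex.sq x
    herm := hV.hermitian x
    dualU := fun v => congrArg (fun α : Rn N →L[ℝ] ℝ => α v) (hinv.self_apply_inverse (θ x))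
    dualV := fun v => congrArg (fun α : Rn N →L[ℝ] ℝ => α v)
      (hinv.self_apply_inverse ((θ x).comp (J x)))
    unit := hθ x }

lemma metricInChart_pos (g : Metric N M) (p : M) {y : Rn N}
    (hy : y ∈ (chartAt (Rn N) p).target) (u : Rn N) (hu : u ≠ 0) :
    0 < metricInChart g p y u u := by
  refine g.pos _ _ fun h => hu ?_
  exact (chartDeriv_chartInvDeriv p hy u).symm.trans
    ((congrArg (chartDeriv p y) h).trans (map_zero _))

lemma isLocalVaisman (hV : IsVaisman J g θ) (hθ : ∀ x, normSq g θ x = 1) (p : M) :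
    IsLocalVaisman (chartAt (Rn N) p).target (metricInChart g p) (endoInChart J p)
      (covInChart θ p) where
  isOpen := (chartAt (Rn N) p).open_target
  smoothG := (smoothBil_iff g.inner).mp g.contMDiff p
  smoothJ := (smoothEndo_iff J).mp hV.complex.smooth p
  smoothLee := (smoothCovector_iff θ).mp hV.smooth p
  symm y _ u v := g.symm _ _ _
  pos y hy := metricInChart_pos g p hy
  sq y hy u := by
    rw [endoInChart_apply, chartInvDeriv_endoInChart J p hy, hV.complex.sq, map_neg,
      chartDeriv_chartInvDeriv p hy]
  herm y hy u v := by
    rw [metricInChart_apply, chartInvDeriv_endoInChart J p hy, chartInvDeriv_endoInChart J p hy,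
      hV.hermitian]
    rfl
  unit y hy := by
    have hL := unitLee_fiber hV hθ ((chartAt (Rn N) p).symm y)
    -- Taking metric duals commutes with passing to the chart, because the dual vector is determined
    -- by its inner products.
    have h1 : sharp (metricInChart g p) y (covInChart θ p y) = chartDeriv p y
        ((g.inner ((chartAt (Rn N) p).symm y)).inverse (θ ((chartAt (Rn N) p).symm y))) := by
      refine eq_of_forall_inner (metricInChart_pos g p hy) fun w => ?_
      rw [apply_sharp (metricInChart_pos g p hy), metricInChart_apply,
        chartInvDeriv_chartDeriv p hy]
      exact (hL.dualU _).symm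
    rw [h1, covInChart_apply, chartInvDeriv_chartDeriv p hy]
    exact hL.unit
  nij y hy u v := hV.complex.integrable p y hy _ _ contDiff_const contDiff_const
  deriv_fundForm := hV.deriv_fundForm p
  parallel := hV.parallel p

lemma deformBil_inChart (a : ℝ) {g' : Metric N M}
    (hg' : ∀ x, g'.inner x = deformBil (N := N) a (g.inner x) (J x) (θ x)) (p : M)
    {y : Rn N} (hy : y ∈ (chartAt (Rn N) p).target) :
    metricInChart g' p y =
      deformMetric a (metricInChart g p) (endoInChart J p) (covInChart θ p) y := by
  ext u v
  rw [metricInChart_apply, hg', deformMetric, deformBil_apply, covInChart_apply, covInChart_apply,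
    covInChart_apply, covInChart_apply, chartInvDeriv_endoInChart J p hy,
    chartInvDeriv_endoInChart J p hy]
  exact deformBil_apply _ _ _ _ _ _

lemma isVonNBounded_deform (hV : IsVaisman J g θ) (hθ : ∀ x, normSq g θ x = 1) {a : ℝ}
    (ha : 0 < a) (x : M) : Bornology.IsVonNBounded ℝ
      {v : TangentSpace 𝓘(ℝ, Rn N) x | deformBil (N := N) a (g.inner x) (J x) (θ x) v v < 1} := by
  have hL := unitLee_fiber hV hθ x
  -- The deformed metric is `a` or `a²` times the old one on the two orthogonal parts, so it
  -- dominates `c g`; its unit ball lies in a dilate of that of `g`.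
  set c := min a (a ^ 2)
  have hc : 0 < c := lt_min ha (by positivity)
  have hs : 0 < Real.sqrt c := Real.sqrt_pos.mpr hc
  refine Bornology.IsVonNBounded.subset ?_ ((g.isVonNBounded x).image
    ((Real.sqrt c)⁻¹ • ContinuousLinearMap.id ℝ (TangentSpace 𝓘(ℝ, Rn N) x)))
  intro v hv
  refine ⟨Real.sqrt c • v, ?_, ?_⟩
  · have h1 := hL.sq_add_sq_le v
    have h2 : a * g.inner x v v + (a ^ 2 - a) * (θ x v * θ x v + θ x (J x v) * θ x (J x v)) < 1 :=
      hv
    have h3 : g.inner x (Real.sqrt c • v) (Real.sqrt c • v) = c * g.inner x v v := by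
      simp only [map_smul, _root_.smul_apply, smul_eq_mul]
      rw [← mul_assoc, Real.mul_self_sqrt hc.le]
    have h4 : c ≤ a := min_le_left _ _
    have h5 : c ≤ a ^ 2 := min_le_right _ _
    change g.inner x (Real.sqrt c • v) (Real.sqrt c • v) < 1
    rw [h3]
    have h6 : 0 ≤ (a - c) * (g.inner x v v - (θ x v ^ 2 + θ x (J x v) ^ 2)) :=
      mul_nonneg (sub_nonneg.mpr h4) (sub_nonneg.mpr h1)
    have h7 : 0 ≤ (a ^ 2 - c) * (θ x v ^ 2 + θ x (J x v) ^ 2) :=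
      mul_nonneg (sub_nonneg.mpr h5) (by positivity)
    linarith
  · simp [smul_smul, hs.ne']

/-- The `Q`-homothetic deformation of the metric of a Vaisman structure with unit Lee form. -/
def deformedMetric (hV : IsVaisman J g θ) (hθ : ∀ x, normSq g θ x = 1) {a : ℝ} (ha : 0 < a) :
    Metric N M where
  inner x := deformBil (N := N) a (g.inner x) (J x) (θ x)
  symm x := (unitLee_fiber hV hθ x).deformBil_symm a
  pos x := (unitLee_fiber hV hθ x).deformBil_pos ha
  isVonNBounded x := isVonNBounded_deform hV hθ ha x
  contMDiff := by
    refine (smoothBil_iff (M := M) (N := N) _).mpr fun p => ?_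
    have hl := isLocalVaisman hV hθ p
    refine ContDiffOn.congr (f := deformMetric a (metricInChart g p) (endoInChart J p)
      (covInChart θ p)) (fun y hy => (contDiffAt_deformBil a (hl.contDiffAtG hy)
        (hl.contDiffAtJ hy) (hl.contDiffAtLee hy)).contDiffWithinAt) fun y hy => ?_
    ext u v
    rw [deformMetric, deformBil_apply, covInChart_apply, covInChart_apply,
      covInChart_apply, covInChart_apply, chartInvDeriv_endoInChart J p hy,
      chartInvDeriv_endoInChart J p hy]
    rfl

lemma isVaisman_deform (hV : IsVaisman J g θ) (hθ : ∀ x, normSq g θ x = 1) {a : ℝ}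
    (ha : 0 < a) : IsVaisman J (deformedMetric hV hθ ha) (fun x => a • θ x) where
  complex := hV.complex
  hermitian x := (unitLee_fiber hV hθ x).deformBil_herm a
  smooth := (smoothCovector_iff _).mpr fun p =>
    ((smoothCovector_iff θ).mp hV.smooth p).const_smul a
  deriv_fundForm p _ hy := (isLocalVaisman hV hθ p).extDerivTwo_deform hy a
    fun _ hz => deformBil_inChart a (fun _ => rfl) p hz
  parallel p _ hy := (isLocalVaisman hV hθ p).nablaForm_deform hy ha
    fun _ hz => deformBil_inChart a (fun _ => rfl) p hz

/-- The Lee form of a Vaisman structure is locally the differential of a smooth function. -/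
lemma exists_local_primitive (hV : IsVaisman J g θ) (hθ : ∀ x, normSq g θ x = 1) (p : M) :
    ∃ W : Set M, IsOpen W ∧ p ∈ W ∧ ∃ f : M → ℝ, ContMDiffOn 𝓘(ℝ, Rn N) 𝓘(ℝ, ℝ) ∞ f W ∧
      ∀ x ∈ W, ∀ v : TangentSpace 𝓘(ℝ, Rn N) x, mfderiv 𝓘(ℝ, Rn N) 𝓘(ℝ, ℝ) f x v = θ x v := by
  set φ := chartAt (Rn N) p
  have hl := isLocalVaisman hV hθ p
  obtain ⟨r, hr, hball⟩ := Metric.isOpen_iff.mp φ.open_target (φ p) (mem_chart_target _ p)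
  set B := Metric.ball (φ p) r
  -- A form that is parallel for a torsion-free connection is closed; the Poincaré lemma on the
  -- convex ball then gives the potential.
  have hcl : ∀ y ∈ B, ∀ u v, fderiv ℝ (covInChart θ p) y u v = fderiv ℝ (covInChart θ p) y v u := by
    intro y hy u v
    have h1 := hl.parallel y (hball hy) u v
    have h2 := hl.parallel y (hball hy) v u
    rw [nablaForm, hl.christoffelG_symm (hball hy)] at h1
    rw [nablaForm] at h2
    linarith
  obtain ⟨f, hf⟩ := (convex_ball (φ p) r).exists_forall_hasFDerivAt_of_fderiv_symmetric
    Metric.isOpen_ball (fun y hy => (hl.diffLee (hball hy)).differentiableWithinAt) hcl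
  have hfs : ContDiffOn ℝ ∞ f B := by
    rw [contDiffOn_infty_iff_fderiv_of_isOpen Metric.isOpen_ball]
    exact ⟨fun y hy => (hf y hy).differentiableAt.differentiableWithinAt,
      (hl.smoothLee.mono hball).congr fun y hy => (hf y hy).fderiv⟩
  refine ⟨φ.source ∩ φ ⁻¹' B, φ.isOpen_inter_preimage Metric.isOpen_ball,
    ⟨mem_chart_source _ p, Metric.mem_ball_self hr⟩, f ∘ φ, ?_, fun x hx v => ?_⟩
  · exact hfs.contMDiffOn.comp ((contMDiffOn_chart (I := 𝓘(ℝ, Rn N)) (x := p) (n := ∞)).mono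
      Set.inter_subset_left) fun x hx => hx.2
  · have hφ : MDifferentiableAt 𝓘(ℝ, Rn N) 𝓘(ℝ, Rn N) φ x :=
      (mdifferentiable_chart (I := 𝓘(ℝ, Rn N)) p).mdifferentiableAt hx.1
    have hfm : MDifferentiableAt 𝓘(ℝ, Rn N) 𝓘(ℝ, ℝ) f (φ x) :=
      (hf _ hx.2).differentiableAt.mdifferentiableAt
    rw [mfderiv_comp x hfm hφ]
    obtain ⟨y, hy, rfl⟩ : ∃ y ∈ φ.target, φ.symm y = x :=
      ⟨φ x, φ.map_source hx.1, φ.left_inv hx.1⟩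
    have hyB : y ∈ B := by simpa [φ.right_inv hy] using hx.2
    have h1 : (mfderiv 𝓘(ℝ, Rn N) 𝓘(ℝ, ℝ) f (φ (φ.symm y)) : Rn N →L[ℝ] ℝ) =
        covInChart θ p y := by
      rw [φ.right_inv hy, mfderiv_eq_fderiv]
      exact (hf y hyB).fderiv
    exact (congrArg (fun L : Rn N →L[ℝ] ℝ => L (chartDeriv p y v)) h1).trans
      (congrArg (θ (φ.symm y)) (chartInvDeriv_chartDeriv p hy v))

end Global

end Vaisman

end

theorem mainTheorem6 {n : ℕ} (hn : 1 ≤ n) {M : Type*} [TopologicalSpace M] [T2Space M]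
    [CompactSpace M] [ConnectedSpace M] [ChartedSpace (Vaisman.Rn (2 * n + 2)) M]
    [IsManifold 𝓘(ℝ, Vaisman.Rn (2 * n + 2)) ∞ M]
    (J : Vaisman.EndoField (2 * n + 2) M) (g : Vaisman.Metric (2 * n + 2) M)
    (θ : Vaisman.CovectorField (2 * n + 2) M)
    (hV : Vaisman.IsVaisman J g θ) (hθ : ∀ x : M, Vaisman.normSq g θ x = 1)
    (lam : ℝ) (hlam : 0 < lam + 1 / 2)
    (hKE : Vaisman.IsTransverselyKahlerEinstein J g θ (lam + 1 / 2)) :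
    ∃ (a : ℝ) (g' : Vaisman.Metric (2 * n + 2) M) (θ' : Vaisman.CovectorField (2 * n + 2) M),
      0 < a ∧ Vaisman.IsQHomotheticDeformation J a g θ g' θ' ∧
      Vaisman.IsVaisman J g' θ' ∧ Vaisman.IsEinsteinWeyl g' θ' := by
  have hN : (0 : ℝ) < ((2 * n + 2 : ℕ) : ℝ) := by positivity
  -- The value of `a` that makes the coefficient of the transverse form in `Ric^D` vanish.
  obtain ⟨a, ha, hκ⟩ : ∃ a : ℝ, 0 < a ∧ lam + 1 / 2 - a / 4 * ((2 * n + 2 : ℕ) : ℝ) = 0 :=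
    ⟨4 * (lam + 1 / 2) / ((2 * n + 2 : ℕ) : ℝ), by positivity, by field_simp; ring⟩
  refine ⟨a, Vaisman.deformedMetric hV hθ ha, fun x => a • θ x, ha,
    ⟨fun _ _ => rfl, fun _ _ _ => rfl⟩, Vaisman.isVaisman_deform hV hθ ha, fun x₀ => ?_⟩
  obtain ⟨W, hW, hx₀, f, hf, hdf⟩ := Vaisman.exists_local_primitive hV hθ x₀
  -- The constant `c` has to be `0`: `Ric^D` is a multiple of the transverse form, which is
  -- degenerate along `U`, while the deformed metric is not.
  refine ⟨W, hW, hx₀, fun x => a * f x, 0, contMDiffOn_const.mul hf, fun x hx v => ?_,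
    fun p y hy _ v w => ?_⟩
  · have h1 : MDifferentiableAt 𝓘(ℝ, Vaisman.Rn (2 * n + 2)) 𝓘(ℝ, ℝ) f x :=
      (hf.contMDiffAt (hW.mem_nhds hx)).mdifferentiableAt (by simp)
    have h2 := (h1.hasMFDerivAt.const_smul a).mfderiv
    exact (congrArg (fun L : Vaisman.Rn (2 * n + 2) →L[ℝ] ℝ => L v) h2).trans
      (congrArg (a * ·) (hdf x hx v))
  · have h1 := (Vaisman.isLocalVaisman hV hθ p).ricci_deform hy ha
      (fun _ hz => Vaisman.deformBil_inChart a (g' := Vaisman.deformedMetric hV hθ ha)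
        (fun _ => rfl) p hz) (fun v w h1 h2 h3 h4 => hKE p y hy v w h1 h2 h3 h4) v w
    rw [hκ, zero_mul] at h1
    rw [zero_mul, zero_mul]
    exact h1
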